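/- Let $1\le k\le s\le \bar d$ be integers and let $\Theta^*\in\mathbb{R}^{\bar d\times\bar d}$ have rank $s$ and singular values $\sigma^*_1\ge\sigma^*_2\ge\dots\ge\sigma^*_{\bar d}\ge 0$. For $\Theta\in\mathbb{R}^{\bar d\times\bar d}$ with vector of singular values $\sigma(\Theta)\in\mathbb{R}^{\bar d}$ (in non-ascending order), the spectral $k$-support norm is $$\|\Theta\|_{k\text{-sp}}=\inf\Big\{\sum_{g\in\mathcal G_k}\|v_g\|_2:\ v_g\in\mathbb{R}^{\bar d},\ \operatorname{supp}(v_g)\subseteq g,\ \sum_{g\in\mathcal G_k}v_g=\sigma(\Theta)\Big\},\qquad \mathcal G_k=\{g\subseteq\{1,\dots,\bar d\}:|g|\le k\}.$$ Let $\mathcal R=\|\cdot\|_{k\text{-sp}}$ and let $\mathcal{E}_{\mathcal R}=\operatorname{cone}\{\Delta:\mathcal R(\Theta^*+\Delta)\le\mathcal R(\Theta^*)\}\cap\{X:\|X\|_F=1\}$ be its error set at $\Theta^*$. For $S\subseteq\mathbb{R}^{\bar d\times\bar d}$ let $w_G(S)=\mathbb{E}\sup_{X\in S}\langle X,G\rangle$,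 where $G$ has independent standard Gaussian entries (and $w_G(\emptyset)=0$). Let $r\in\{0,1,\dots,k-1\}$ be the unique integer with $$\sigma^*_{k-r-1}>\frac1{r+1}\sum_{i=k-r}^{\bar d}\sigma^*_i\ge\sigma^*_{k-r}$$ (with the convention $\sigma^*_0=+\infty$), and put $I_2=\{1,\dots,k-r-1\}$, $I_1=\{k-r,\dots,s\}$; write $\sigma^*_I$ for the vector that agrees with $\sigma^*$ on $I$ and is $0$ elsewhere. Then $$w_G^2(\mathcal E_{\mathcal R})\le s(2\bar d-s)+2\Big(\frac{(r+1)^2\|\sigma^*_{I_2}\|_2^2}{\|\sigma^*_{I_1}\|_1^2}+|I_1|\Big)(2\bar d-s).$$ -/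

import Mathlib

open MeasureTheory ProbabilityTheory

noncomputable section

/-- The entrywise (trace) inner product `⟨X, Y⟩ = ∑ i j, X i j * Y i j`. -/
def matInner {m n : ℕ} (X Y : Matrix (Fin m) (Fin n) ℝ) : ℝ :=
  ∑ i, ∑ j, X i j * Y i j

/-- The Frobenius norm `‖X‖_F = √⟨X, X⟩`. -/
def frobNorm {m n : ℕ} (X : Matrix (Fin m) (Fin n) ℝ) : ℝ :=
  √(matInner X X)

/-- The unit Frobenius sphere. -/
def frobSphere (m n : ℕ) : Set (Matrix (Fin m) (Fin n) ℝ) :=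
  {X | frobNorm X = 1}

/-- The law of an `m × n` array of independent standard Gaussian random variables. -/
def stdGaussianArray (m n : ℕ) : Measure (Fin m → Fin n → ℝ) :=
  Measure.pi fun _ => Measure.pi fun _ => gaussianReal 0 1

instance (m n : ℕ) : IsProbabilityMeasure (stdGaussianArray m n) := by
  unfold stdGaussianArray; infer_instance

/-- The support function `G ↦ sup_{X ∈ S} ⟨X, G⟩`. -/
def supInner {m n : ℕ} (S : Set (Matrix (Fin m) (Fin n) ℝ)) (G : Matrix (Fin m) (Fin n) ℝ) : ℝ :=
  sSup ((fun X => matInner X G) '' S)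

/-- The Gaussian width `w_G(S) = E sup_{X ∈ S} ⟨X, G⟩`, with `G` a matrix of independent standard
Gaussian variables. For bounded `S` the supremum is finite and integrable, see
`bddAbove_matInner` and `integrable_supInner`. -/
def gaussianWidth {m n : ℕ} (S : Set (Matrix (Fin m) (Fin n) ℝ)) : ℝ :=
  ∫ G, supInner S (Matrix.of G) ∂(stdGaussianArray m n)

theorem abs_matInner_le {m n : ℕ} {X : Matrix (Fin m) (Fin n) ℝ} {C : ℝ}
    (hX : ∀ i j, |X i j| ≤ C) (G : Matrix (Fin m) (Fin n) ℝ) :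
    |matInner X G| ≤ ∑ i, ∑ j, C * |G i j| := by
  unfold matInner
  refine (Finset.abs_sum_le_sum_abs _ _).trans (Finset.sum_le_sum fun i _ => ?_)
  refine (Finset.abs_sum_le_sum_abs _ _).trans (Finset.sum_le_sum fun j _ => ?_)
  rw [abs_mul]
  exact mul_le_mul_of_nonneg_right (hX i j) (abs_nonneg _)

theorem bddAbove_matInner {m n : ℕ} {S : Set (Matrix (Fin m) (Fin n) ℝ)} {C : ℝ}
    (hS : ∀ X ∈ S, ∀ i j, |X i j| ≤ C) (G : Matrix (Fin m) (Fin n) ℝ) :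
    BddAbove ((fun X => matInner X G) '' S) := by
  refine ⟨∑ i, ∑ j, C * |G i j|, ?_⟩
  rintro _ ⟨X, hX, rfl⟩
  exact (le_abs_self _).trans (abs_matInner_le (hS X hX) G)

theorem integrable_supInner {m n : ℕ} {S : Set (Matrix (Fin m) (Fin n) ℝ)} {C : ℝ}
    (hS : ∀ X ∈ S, ∀ i j, |X i j| ≤ C) :
    Integrable (fun G : Fin m → Fin n → ℝ => supInner S (Matrix.of G))
      (stdGaussianArray m n) := by
  rcases S.eq_empty_or_nonempty with rfl | hne
  · simp [supInner]
  have key : ∀ G H : Fin m → Fin n → ℝ, supInner S (Matrix.of G) ≤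
      supInner S (Matrix.of H) + ∑ i, ∑ j, C * |G i j - H i j| := by
    intro G H
    refine csSup_le (hne.image _) ?_
    rintro _ ⟨X, hX, rfl⟩
    have h1 : matInner X (Matrix.of G) =
        matInner X (Matrix.of H) + matInner X (Matrix.of (G - H)) := by
      simp only [matInner, ← Finset.sum_add_distrib]
      refine Finset.sum_congr rfl fun i _ => Finset.sum_congr rfl fun j _ => ?_
      simp only [Matrix.of_apply, Pi.sub_apply]
      ring
    have h2 := le_csSup (bddAbove_matInner hS (Matrix.of H)) (Set.mem_image_of_mem _ hX)
    have h3 := (le_abs_self _).trans (abs_matInner_le (hS X hX) (Matrix.of (G - H)))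
    simp only [Matrix.of_apply, Pi.sub_apply] at h3
    change matInner X (Matrix.of G) ≤ _
    rw [h1]
    exact add_le_add h2 h3
  have hcont : Continuous fun G : Fin m → Fin n → ℝ => supInner S (Matrix.of G) := by
    rw [continuous_iff_continuousAt]
    intro H
    have hz : Filter.Tendsto (fun G : Fin m → Fin n → ℝ => ∑ i, ∑ j, C * |G i j - H i j|)
        (nhds H) (nhds 0) := by
      have : Continuous fun G : Fin m → Fin n → ℝ => ∑ i, ∑ j, C * |G i j - H i j| := by
        fun_prop
      simpa using this.tendsto H
    refine tendsto_iff_dist_tendsto_zero.2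
      (squeeze_zero (fun _ => dist_nonneg) (fun G => ?_) hz)
    rw [Real.dist_eq, abs_le]
    have h1 := key G H
    have h2 := key H G
    simp only [abs_sub_comm (H _ _)] at h2
    constructor <;> linarith
  have hint : Integrable (fun G : Fin m → Fin n → ℝ => ∑ i, ∑ j, C * |G i j|)
      (stdGaussianArray m n) := by
    refine integrable_finsetSum _ fun i _ => integrable_finsetSum _ fun j _ => ?_
    have h0 : Integrable (fun x : ℝ => C * |x|) (gaussianReal 0 1) :=
      ((memLp_id_gaussianReal 1).integrable (by simp)).abs.const_mul C
    have h1 : Integrable (fun v : Fin n → ℝ => C * |v j|)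
        (Measure.pi fun _ => gaussianReal 0 1) :=
      (measurePreserving_eval (fun _ : Fin n => gaussianReal 0 1) j).integrable_comp_of_integrable
        h0
    exact (measurePreserving_eval
      (fun _ : Fin m => Measure.pi fun _ : Fin n => gaussianReal 0 1) i).integrable_comp_of_integrable
        h1
  refine hint.mono' hcont.aestronglyMeasurable (Filter.Eventually.of_forall fun G => ?_)
  have h0 : supInner S (Matrix.of 0) = 0 := by
    have : (fun X : Matrix (Fin m) (Fin n) ℝ => matInner X (Matrix.of 0)) = fun _ => 0 := by
      funext X; simp [matInner]
    rw [supInner, this, hne.image_const, csSup_singleton]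
  have h1 := key G 0
  have h2 := key 0 G
  simp only [Pi.zero_apply, sub_zero, zero_sub, abs_neg, h0] at h1 h2
  rw [Real.norm_eq_abs, abs_le]
  constructor <;> linarith

/-- The `i`-th largest singular value `σ_i` of `Θ`, counted from `i = 1`. -/
def singVal {d : ℕ} (Θ : Matrix (Fin d) (Fin d) ℝ) (i : ℕ) : ℝ :=
  (Matrix.toEuclideanLin Θ).singularValues (i - 1)

/-- The vector `σ(Θ) ∈ ℝ^d` of singular values in non-ascending order. -/
def singVec {d : ℕ} (Θ : Matrix (Fin d) (Fin d) ℝ) : EuclideanSpace ℝ (Fin d) :=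
  WithLp.toLp 2 fun i => singVal Θ (i + 1)

/-- The family of all subsets of `[d]` of cardinality at most `k`. -/
def subsetsCardLE (k d : ℕ) : Finset (Finset (Fin d)) :=
  Finset.univ.filter fun g => g.card ≤ k

/-- The vector `k`-support norm
`inf {∑_g ‖v_g‖₂ : supp v_g ⊆ g, ∑_g v_g = w}`, with `g` ranging over the subsets of `[d]` of
cardinality at most `k`. -/
def kSupportNorm (k : ℕ) {d : ℕ} (w : EuclideanSpace ℝ (Fin d)) : ℝ :=
  sInf {x : ℝ | ∃ v : Finset (Fin d) → EuclideanSpace ℝ (Fin d),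
    (∀ g ∈ subsetsCardLE k d, ∀ i, i ∉ g → v g i = 0) ∧
    ∑ g ∈ subsetsCardLE k d, v g = w ∧
    x = ∑ g ∈ subsetsCardLE k d, ‖v g‖}

/-- The spectral `k`-support norm: the vector `k`-support norm of the singular values. -/
def spectralKSupportNorm (k : ℕ) {d : ℕ} (Θ : Matrix (Fin d) (Fin d) ℝ) : ℝ :=
  kSupportNorm k (singVec Θ)

/-- The error cone `cone {Δ : R(Θ + Δ) ≤ R(Θ)}`. -/
def errorCone {m n : ℕ} (R : Matrix (Fin m) (Fin n) ℝ → ℝ) (Θ : Matrix (Fin m) (Fin n) ℝ) :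
    ConvexCone ℝ (Matrix (Fin m) (Fin n) ℝ) :=
  ConvexCone.hull ℝ {Δ | R (Θ + Δ) ≤ R Θ}

/-- The error set: the part of the error cone on the unit Frobenius sphere. -/
def errorSet {m n : ℕ} (R : Matrix (Fin m) (Fin n) ℝ → ℝ) (Θ : Matrix (Fin m) (Fin n) ℝ) :
    Set (Matrix (Fin m) (Fin n) ℝ) :=
  (errorCone R Θ : Set (Matrix (Fin m) (Fin n) ℝ)) ∩ frobSphere m n

/-- `r ∈ {0, …, k-1}` and
`σ_{k-r-1} > (1/(r+1)) ∑_{i=k-r}^{d} σ_i ≥ σ_{k-r}`, with the convention `σ_0 = +∞`. -/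
def IsKSupportIndex (k : ℕ) {d : ℕ} (Θ : Matrix (Fin d) (Fin d) ℝ) (r : ℕ) : Prop :=
  r < k ∧
  (1 ≤ k - r - 1 →
    (1 / ((r : ℝ) + 1)) * ∑ i ∈ Finset.Icc (k - r) d, singVal Θ i < singVal Θ (k - r - 1)) ∧
  singVal Θ (k - r) ≤ (1 / ((r : ℝ) + 1)) * ∑ i ∈ Finset.Icc (k - r) d, singVal Θ i

/-- The index `r` in the previous definition exists and is unique when `1 ≤ k ≤ d`. -/
theorem existsUnique_isKSupportIndex {k d : ℕ} (hk : 1 ≤ k) (hkd : k ≤ d)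
    (Θ : Matrix (Fin d) (Fin d) ℝ) : ∃! r, IsKSupportIndex k Θ r := by
  classical
  have hanti : Antitone (singVal Θ) := fun a b hab =>
    (Matrix.toEuclideanLin Θ).singularValues_antitone (Nat.sub_le_sub_right hab 1)
  have hnn : ∀ i, 0 ≤ singVal Θ i := fun i =>
    (Matrix.toEuclideanLin Θ).singularValues_nonneg _
  have hsum : ∀ r, r + 1 < k → ∑ i ∈ Finset.Icc (k - (r + 1)) d, singVal Θ i =
      singVal Θ (k - (r + 1)) + ∑ i ∈ Finset.Icc (k - r) d, singVal Θ i := by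
    intro r hr
    rw [← Finset.insert_Icc_add_one_left_eq_Icc (by lia : k - (r + 1) ≤ d),
      Finset.sum_insert (by simp), show k - (r + 1) + 1 = k - r by lia]
  have hpos : ∀ r : ℕ, (0 : ℝ) < (r : ℝ) + 1 := fun r => by positivity
  set Q : ℕ → Prop := fun r =>
    ((r : ℝ) + 1) * singVal Θ (k - r) ≤ ∑ i ∈ Finset.Icc (k - r) d, singVal Θ i with hQ
  have hiff : ∀ r, IsKSupportIndex k Θ r ↔ r < k ∧ Q r ∧ (r + 1 < k → ¬ Q (r + 1)) := by
    intro r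
    have e1 : singVal Θ (k - r) ≤ (1 / ((r : ℝ) + 1)) *
        ∑ i ∈ Finset.Icc (k - r) d, singVal Θ i ↔ Q r := by
      rw [one_div_mul_eq_div, le_div_iff₀ (hpos r), mul_comm]
    have e2 : r + 1 < k → ((1 / ((r : ℝ) + 1)) * ∑ i ∈ Finset.Icc (k - r) d, singVal Θ i <
        singVal Θ (k - r - 1) ↔ ¬ Q (r + 1)) := by
      intro hr
      simp only [hQ, hsum r hr, not_le]
      rw [one_div_mul_eq_div, div_lt_iff₀ (hpos r), Nat.sub_sub]
      push_cast
      constructor <;> intro h <;> linarith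
    have e3 : 1 ≤ k - r - 1 ↔ r + 1 < k := by lia
    unfold IsKSupportIndex
    rw [e1, e3]
    constructor
    · rintro ⟨a, b, c⟩
      exact ⟨a, c, fun h => (e2 h).1 (b h)⟩
    · rintro ⟨a, b, c⟩
      exact ⟨a, fun h => (e2 h).2 (c h), b⟩
  have hdown : ∀ r, r + 1 < k → Q (r + 1) → Q r := by
    intro r hr h
    simp only [hQ, hsum r hr] at h
    have h1 : singVal Θ (k - r) ≤ singVal Θ (k - (r + 1)) := hanti (by lia)
    have h2 := mul_le_mul_of_nonneg_left h1 (hpos r).le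
    simp only [hQ]
    push_cast at h
    linarith
  have hdown' : ∀ b, b < k → Q b → ∀ a, a ≤ b → Q a := by
    intro b
    induction b with
    | zero => intro _ h a ha; rwa [Nat.le_zero.1 ha]
    | succ n ih =>
      intro hn h a ha
      rcases Nat.lt_or_ge n a with h' | h'
      · rwa [show a = n + 1 by lia]
      · exact ih (by lia) (hdown n hn h) a h'
  have h0 : Q 0 := by
    have := Finset.single_le_sum (f := singVal Θ) (fun i _ => hnn i)
      (Finset.mem_Icc.2 ⟨le_refl k, hkd⟩)
    simpa [hQ] using this
  refine ⟨Nat.findGreatest Q (k - 1), (hiff _).2 ⟨?_, ?_, ?_⟩, ?_⟩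
  · have := Nat.findGreatest_le (P := Q) (k - 1)
    lia
  · exact Nat.findGreatest_spec (Nat.zero_le _) h0
  · intro h
    exact Nat.findGreatest_is_greatest (Nat.lt_succ_self _) (by lia)
  · intro r hr
    obtain ⟨a, b, c⟩ := (hiff r).1 hr
    refine le_antisymm (Nat.le_findGreatest (by lia) b) ?_
    by_contra! h
    have hle := Nat.findGreatest_le (P := Q) (k - 1)
    have hs := Nat.findGreatest_spec (P := Q) (Nat.zero_le (k - 1)) h0
    exact c (by lia) (hdown' _ (by lia) hs _ h)

end

/-! The width is bounded by the mean squared distance from G to a random point of the normal cone.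
In singular bases of `Θ`, let t be the operator norm of the trailing (d-s)×(d-s) block of G. Let W
copy that block, carry t·D_j at the j-th of the first s diagonal places, and vanish elsewhere. Here
D_j = (r+1)σ_j/S on I₂ and D_j = 1 on I₁, with S = ‖σ_{I₁}‖₁. Every descent direction satisfies ⟨Δ,
W⟩ ≤ 0 (`matInner_dualArray_nonpos`), and so does the cone they generate. Hence ⟨X, G⟩ ≤ ⟨X, G - W⟩
≤ ‖G - W‖_F on the error set, and Jensen's inequality gives w² ≤ E‖G - W‖_F².

G - W vanishes on the trailing block, and t is independent of the leading diagonal entries of G. So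
the expectation is s(2d-s) + E[t²]·∑D_j², where ∑D_j² is the bracket in the theorem
(`sum_subgradientDiag_sq`). The bound E[t²] ≤ 4(d-s) ≤ 2(2d-s) finishes the proof.

The sign of ⟨Δ, W⟩ comes from two matching estimates with M² = ‖σ_{I₂}‖₂² + S²/(r+1). The norm of
`Θ` is at most M (`spectralKSupportNorm_le`), by an explicit decomposition coming from Birkhoff's
theorem. Duality with the 2-k Ky Fan norm gives ⟨Y, W⟩ ≤ κM‖Y‖ for all Y, while ⟨Θ, W⟩ = κM², with κ
= t(r+1)/S.

The second moment of the operator norm (`integral_arrayOp_sq_le`) comes from Gaussian comparison of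
⟨u, Gv⟩ + g with ⟨g, u⟩ + ⟨h, v⟩. It is run on the square of a soft maximum, so that no
concentration inequality is needed to pass from the mean to the second moment. -/

/-! ### Gaussian integration by parts. -/

theorem hasDerivAt_gaussianPDFReal_zero_one (x : ℝ) :
    HasDerivAt (gaussianPDFReal 0 1) (-(x * gaussianPDFReal 0 1 x)) x := by
  have h : HasDerivAt (fun x : ℝ => -(x - 0) ^ 2 / (2 * ((1 : NNReal) : ℝ))) (-x) x := by
    have := (((hasDerivAt_id x).sub_const 0).pow 2).neg.div_const (2 * ((1 : NNReal) : ℝ))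
    convert! this using 1
    simp
    ring
  have h2 := h.exp.const_mul (√(2 * Real.pi * ((1 : NNReal) : ℝ)))⁻¹
  convert! h2 using 1
  simp only [gaussianPDFReal]
  ring

theorem integrable_gaussianReal_zero_one_iff {f : ℝ → ℝ} :
    Integrable f (gaussianReal 0 1) ↔ Integrable (fun x => gaussianPDFReal 0 1 x * f x) := by
  rw [gaussianReal_of_var_ne_zero 0 one_ne_zero,
    integrable_withDensity_iff_integrable_smul' (measurable_gaussianPDF 0 1)
      (Filter.Eventually.of_forall fun x => ENNReal.ofReal_lt_top)]
  simp [gaussianPDF, ENNReal.toReal_ofReal, gaussianPDFReal_nonneg]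

/-- Gaussian integration by parts on the line (Stein's identity). -/
theorem integral_id_mul_gaussianReal {f f' : ℝ → ℝ} (hf : ∀ x, HasDerivAt f (f' x) x)
    (hfi : Integrable f (gaussianReal 0 1))
    (hxf : Integrable (fun x => x * f x) (gaussianReal 0 1))
    (hfi' : Integrable f' (gaussianReal 0 1)) :
    ∫ x, x * f x ∂(gaussianReal 0 1) = ∫ x, f' x ∂(gaussianReal 0 1) := by
  rw [integrable_gaussianReal_zero_one_iff] at hfi hxf hfi'
  rw [integral_gaussianReal_eq_integral_smul one_ne_zero,
    integral_gaussianReal_eq_integral_smul one_ne_zero]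
  simp only [smul_eq_mul]
  have := integral_mul_deriv_eq_deriv_mul_of_integrable
    (fun x _ => hasDerivAt_gaussianPDFReal_zero_one x) (fun x _ => hf x) hfi'
    (hxf.neg.congr (Filter.Eventually.of_forall fun x => by simp; ring)) hfi
  rw [this, ← integral_neg]
  congr 1
  ext x
  ring

/-- Fubini isolates the k-th coordinate, and the one-dimensional identity applies on almost every
line parallel to it. -/
theorem integral_eval_mul_pi_gaussianReal {n : ℕ} (k : Fin n) {f f' : (Fin n → ℝ) → ℝ}
    (hf : ∀ z, HasDerivAt (fun t => f (Function.update z k t)) (f' z) (z k))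
    (hfi : Integrable f (Measure.pi fun _ => gaussianReal 0 1))
    (hzf : Integrable (fun z => z k * f z) (Measure.pi fun _ => gaussianReal 0 1))
    (hfi' : Integrable f' (Measure.pi fun _ => gaussianReal 0 1)) :
    ∫ z, z k * f z ∂(Measure.pi fun _ => gaussianReal 0 1) =
      ∫ z, f' z ∂(Measure.pi fun _ => gaussianReal 0 1) := by
  cases n with
  | zero => exact k.elim0
  | succ n =>
    have hmp := (measurePreserving_piFinSuccAbove
      (fun _ : Fin (n + 1) => gaussianReal 0 1) k).symm
    have hcoe : ∀ p : ℝ × (Fin n → ℝ), (MeasurableEquiv.piFinSuccAbove (fun _ => ℝ) k).symm p =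
      k.insertNth p.1 p.2 := fun p => rfl
    rw [← hmp.integrable_comp_emb (MeasurableEquiv.measurableEmbedding _)] at hfi hzf hfi'
    simp only [Function.comp_def] at hfi hzf hfi'
    rw [← hmp.integral_comp', ← hmp.integral_comp', integral_prod_symm _ hzf,
      integral_prod_symm _ hfi']
    refine integral_congr_ae ?_
    filter_upwards [hfi.prod_left_ae, hzf.prod_left_ae, hfi'.prod_left_ae] with y h1 h2 h3
    simp only [hcoe, Fin.insertNth_apply_same] at h1 h2 h3 ⊢
    refine integral_id_mul_gaussianReal (fun x => ?_) h1 h2 h3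
    have := hf (k.insertNth x y)
    simpa using this

section

variable {E : Type*} [NormedAddCommGroup E] [InnerProductSpace ℝ E] [FiniteDimensional ℝ E]
  [MeasurableSpace E] [BorelSpace E]

/-- Gaussian integration by parts in a Euclidean space. -/
theorem integral_inner_mul_stdGaussian (c : E) {f : E → ℝ} {f' : E → E →L[ℝ] ℝ}
    (hf : ∀ z, HasFDerivAt f (f' z) z) (hfi : Integrable f (stdGaussian E))
    (hzf : Integrable (fun z => ‖z‖ * f z) (stdGaussian E))
    (hfi' : ∀ v, Integrable (fun z => f' z v) (stdGaussian E)) :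
    ∫ z, inner ℝ c z * f z ∂(stdGaussian E) = ∫ z, f' z c ∂(stdGaussian E) := by
  have hcont : Continuous f := continuous_iff_continuousAt.2 fun z => (hf z).continuousAt
  have hint : ∀ v : E, Integrable (fun z => inner ℝ v z * f z) (stdGaussian E) := by
    intro v
    refine (hzf.norm.const_mul ‖v‖).mono' (by fun_prop) (Filter.Eventually.of_forall fun z => ?_)
    rw [norm_mul, norm_mul, norm_norm, ← mul_assoc]
    gcongr
    exact norm_inner_le_norm v z
  obtain ⟨e, he⟩ : ∃ e, e = stdOrthonormalBasis ℝ E := ⟨_, rfl⟩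
  have hbasis : ∀ k, ∫ z, inner ℝ (e k) z * f z ∂(stdGaussian E) =
      ∫ z, f' z (e k) ∂(stdGaussian E) := by
    intro k
    have hm : AEMeasurable (fun x : Fin (Module.finrank ℝ E) → ℝ => ∑ i, x i • e i)
        (Measure.pi fun _ => gaussianReal 0 1) := Measurable.aemeasurable (by fun_prop)
    have h1 := hint (e k)
    have h2 := hfi' (e k)
    have h3 := hfi
    rw [stdGaussian, ← he] at h1 h2 h3 ⊢
    rw [integral_map hm h1.1, integral_map hm h2.1]
    have hk : ∀ x : Fin (Module.finrank ℝ E) → ℝ, inner ℝ (e k) (∑ i, x i • e i) = x k :=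
      fun x => e.orthonormal.inner_right_fintype x k
    replace h1 := h1.comp_aemeasurable hm
    simp only [Function.comp_def, hk] at h1
    simp only [hk]
    refine integral_eval_mul_pi_gaussianReal k (f := fun x => f (∑ i, x i • e i)) (fun x => ?_)
      (h3.comp_aemeasurable hm) h1 (h2.comp_aemeasurable hm)
    have hc : HasDerivAt (fun t : ℝ => ∑ i, Function.update x k t i • e i) (e k) (x k) := by
      have : ∀ t : ℝ, ∑ i, Function.update x k t i • e i =
          ∑ i, x i • e i + (t - x k) • e k := by
        intro t
        rw [← Finset.add_sum_erase _ _ (Finset.mem_univ k),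
          ← Finset.add_sum_erase _ (fun i => x i • e i) (Finset.mem_univ k),
          Finset.sum_congr rfl (g := fun i => x i • e i) fun i hi => by
            rw [Function.update_of_ne (Finset.ne_of_mem_erase hi)]]
        simp only [Function.update_self]
        module
      simp only [this]
      have h := (((hasDerivAt_id (x k)).sub_const (x k)).smul_const (e k)).const_add
        (∑ i, x i • e i)
      simpa using h
    have := (hf (∑ i, x i • e i)).comp_hasDerivAt_of_eq (x k) hc (by simp)
    exact this
  have hc : c = ∑ k, inner ℝ (e k) c • e k := (e.sum_repr' c).symm
  calc ∫ z, inner ℝ c z * f z ∂(stdGaussian E)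
      = ∫ z, ∑ k, inner ℝ (e k) c * (inner ℝ (e k) z * f z) ∂(stdGaussian E) := by
        congr 1
        ext z
        conv_lhs => rw [hc]
        rw [sum_inner, Finset.sum_mul]
        simp only [real_inner_smul_left, mul_assoc]
    _ = ∑ k, inner ℝ (e k) c * ∫ z, f' z (e k) ∂(stdGaussian E) := by
        rw [integral_finsetSum _ fun k _ => (hint _).const_mul _]
        simp only [integral_const_mul, hbasis]
    _ = ∫ z, f' z c ∂(stdGaussian E) := by
        simp only [← integral_const_mul]
        rw [← integral_finsetSum _ fun k _ => (hfi' _).const_mul _]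
        congr 1
        ext z
        conv_rhs => rw [hc, map_sum]
        simp only [map_smul, smul_eq_mul]

end

/-! ### The soft maximum and its derivatives. -/

noncomputable section

/-- `log (e + ∑ exp x_i)`, a smooth approximation of `max 1 (max x_i)`. -/
def softMax {ι : Type*} [Fintype ι] (x : ι → ℝ) : ℝ :=
  Real.log (Real.exp 1 + ∑ i, Real.exp (x i))

/-- The gradient of `softMax`. -/
def softMaxWeight {ι : Type*} [Fintype ι] (i : ι) (x : ι → ℝ) : ℝ :=
  Real.exp (x i - softMax x)

end

section

variable {ι : Type*} [Fintype ι]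

theorem exp_softMax (x : ι → ℝ) :
    Real.exp (softMax x) = Real.exp 1 + ∑ i, Real.exp (x i) :=
  Real.exp_log (by positivity)

theorem one_le_softMax (x : ι → ℝ) : 1 ≤ softMax x := by
  rw [← Real.exp_le_exp, exp_softMax]
  linarith [Finset.sum_nonneg fun i (_ : i ∈ Finset.univ) => (Real.exp_pos (x i)).le]

theorem le_softMax (x : ι → ℝ) (i : ι) : x i ≤ softMax x := by
  rw [← Real.exp_le_exp, exp_softMax]
  have := Finset.single_le_sum (f := fun i => Real.exp (x i))
    (fun i _ => (Real.exp_pos (x i)).le) (Finset.mem_univ i)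
  linarith [Real.exp_pos 1]

/-- Every exponential is at most exp c, and c ≥ 0 lets the constant term e be absorbed into the same
factor. -/
theorem softMax_le {x : ι → ℝ} {c : ℝ} (hc : 0 ≤ c) (hx : ∀ i, x i ≤ c) :
    softMax x ≤ Real.log (Real.exp 1 + Fintype.card ι) + c := by
  have h : Real.log (Real.exp 1 + Fintype.card ι) + c =
      Real.log ((Real.exp 1 + Fintype.card ι) * Real.exp c) := by
    rw [Real.log_mul (by positivity) (by positivity), Real.log_exp]
  rw [h]
  refine Real.log_le_log (by positivity) ?_
  rw [add_mul]
  refine add_le_add (le_mul_of_one_le_right (Real.exp_pos 1).le (Real.one_le_exp hc)) ?_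
  have := Finset.sum_le_sum fun i (_ : i ∈ Finset.univ) => Real.exp_le_exp.2 (hx i)
  simpa using this

theorem softMaxWeight_pos (i : ι) (x : ι → ℝ) : 0 < softMaxWeight i x := Real.exp_pos _

theorem softMaxWeight_le_one (i : ι) (x : ι → ℝ) : softMaxWeight i x ≤ 1 :=
  Real.exp_le_one_iff.2 (sub_nonpos.2 (le_softMax x i))

theorem hasFDerivAt_softMax (x : ι → ℝ) :
    HasFDerivAt softMax (∑ i, softMaxWeight i x • ContinuousLinearMap.proj (R := ℝ)
      (φ := fun _ : ι => ℝ) i) x := by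
  have h1 : HasFDerivAt (fun x : ι → ℝ => Real.exp 1 + ∑ i, Real.exp (x i))
      (∑ i, Real.exp (x i) • ContinuousLinearMap.proj (R := ℝ) (φ := fun _ : ι => ℝ) i) x :=
    (HasFDerivAt.fun_sum fun i _ => (hasFDerivAt_apply i x).exp).const_add _
  have h2 := h1.log (by positivity)
  convert! h2 using 1
  rw [Finset.smul_sum]
  refine Finset.sum_congr rfl fun i _ => ?_
  rw [smul_smul, softMaxWeight, Real.exp_sub, exp_softMax, div_eq_inv_mul]

theorem continuous_softMax : Continuous (softMax : (ι → ℝ) → ℝ) :=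
  continuous_iff_continuousAt.2 fun x => (hasFDerivAt_softMax x).continuousAt

theorem continuous_softMaxWeight (i : ι) : Continuous (softMaxWeight i) := by
  unfold softMaxWeight
  have := continuous_softMax (ι := ι)
  fun_prop

/-- The differentiated function is half the i-th partial derivative of the squared soft maximum S².
For j ≠ i the coefficient is p_i p_j (1 - S), which is non-positive because S ≥ 1. The extra term e
in `softMax` is there for this sign. -/
theorem hasFDerivAt_softMaxWeight_mul (i : ι) (x : ι → ℝ) :
    HasFDerivAt (fun x => softMaxWeight i x * softMax x)
      ((softMaxWeight i x * softMax x) • ContinuousLinearMap.proj (R := ℝ)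
          (φ := fun _ : ι => ℝ) i +
        (softMaxWeight i x * (1 - softMax x)) • ∑ j, softMaxWeight j x •
          ContinuousLinearMap.proj (R := ℝ) (φ := fun _ : ι => ℝ) j) x := by
  have h1 : HasFDerivAt (softMaxWeight i) (softMaxWeight i x • (ContinuousLinearMap.proj (R := ℝ)
      (φ := fun _ : ι => ℝ) i - ∑ j, softMaxWeight j x • ContinuousLinearMap.proj (R := ℝ)
      (φ := fun _ : ι => ℝ) j)) x :=
    ((hasFDerivAt_apply i x).sub (hasFDerivAt_softMax x)).exp
  convert! h1.mul (hasFDerivAt_softMax x) using 1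
  ext v
  simp only [add_apply, smul_apply, sub_apply, smul_eq_mul]
  ring

variable {E : Type*} [NormedAddCommGroup E] [InnerProductSpace ℝ E]

/-- Linear growth, which makes the squares and products below integrable for the Gaussian measure.
-/
theorem softMax_inner_le {a : ι → E} {K : ℝ} (hK : 0 ≤ K) (ha : ∀ i, ‖a i‖ ≤ K) (z : E) :
    softMax (fun i => inner ℝ (a i) z) ≤
      (Real.log (Real.exp 1 + Fintype.card ι) + K) * (1 + ‖z‖) := by
  have h : ∀ i, inner ℝ (a i) z ≤ K * ‖z‖ := fun i =>
    (real_inner_le_norm _ _).trans (mul_le_mul_of_nonneg_right (ha i) (norm_nonneg z))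
  have h1 := softMax_le (mul_nonneg hK (norm_nonneg z)) h
  have h2 : 0 ≤ Real.log (Real.exp 1 + Fintype.card ι) := Real.log_nonneg (by
    have := Real.add_one_le_exp 1
    have := (Nat.cast_nonneg (Fintype.card ι) : (0 : ℝ) ≤ _)
    linarith)
  nlinarith [norm_nonneg z]

theorem hasFDerivAt_softMaxWeight_mul_inner (a : ι → E) (i : ι) (z : E) :
    HasFDerivAt (fun z => softMaxWeight i (fun i => inner ℝ (a i) z) *
        softMax (fun i => inner ℝ (a i) z))
      ((softMaxWeight i (fun i => inner ℝ (a i) z) * softMax (fun i => inner ℝ (a i) z)) •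
          innerSL ℝ (a i) +
        (softMaxWeight i (fun i => inner ℝ (a i) z) *
          (1 - softMax (fun i => inner ℝ (a i) z))) •
          ∑ j, softMaxWeight j (fun i => inner ℝ (a i) z) • innerSL ℝ (a j)) z := by
  have h := (hasFDerivAt_softMaxWeight_mul i (fun i => inner ℝ (a i) z)).comp z
    (ContinuousLinearMap.pi fun i => innerSL ℝ (a i)).hasFDerivAt
  convert! h using 1
  ext v
  simp

variable [FiniteDimensional ℝ E] [MeasurableSpace E] [BorelSpace E]

theorem integrable_stdGaussian_of_le_sq {f : E → ℝ} (hf : Continuous f) {C : ℝ}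
    (hC : ∀ z, |f z| ≤ C * (1 + ‖z‖) ^ 2) : Integrable f (stdGaussian E) := by
  have h1 : MemLp (fun z : E => 1 + ‖z‖) 2 (stdGaussian E) :=
    (memLp_const (1 : ℝ)).add (IsGaussian.memLp_id (stdGaussian E) 2 (by simp)).norm
  exact (h1.integrable_sq.const_mul C).mono' hf.aestronglyMeasurable
    (Filter.Eventually.of_forall hC)

theorem integral_inner_mul_softMaxWeight_mul (a : ι → E) (c : E) (i : ι) :
    ∫ z, inner ℝ c z * (softMaxWeight i (fun i => inner ℝ (a i) z) *
        softMax (fun i => inner ℝ (a i) z)) ∂(stdGaussian E) =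
      ∫ z, (softMaxWeight i (fun i => inner ℝ (a i) z) * softMax (fun i => inner ℝ (a i) z) *
          inner ℝ (a i) c +
        softMaxWeight i (fun i => inner ℝ (a i) z) *
          (1 - softMax (fun i => inner ℝ (a i) z)) *
          ∑ j, softMaxWeight j (fun i => inner ℝ (a i) z) * inner ℝ (a j) c)
        ∂(stdGaussian E) := by
  set K := ∑ i, ‖a i‖ with hK
  have hK0 : 0 ≤ K := Finset.sum_nonneg fun i _ => norm_nonneg _
  have haK : ∀ i, ‖a i‖ ≤ K := fun i =>
    Finset.single_le_sum (f := fun i => ‖a i‖) (fun i _ => norm_nonneg _) (Finset.mem_univ i)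
  set M := Real.log (Real.exp 1 + Fintype.card ι) + K
  have hM : ∀ z, softMax (fun i => inner ℝ (a i) z) ≤ M * (1 + ‖z‖) :=
    softMax_inner_le hK0 haK
  have h1 : ∀ z, 1 ≤ softMax (fun i => inner ℝ (a i) z) := fun z => one_le_softMax _
  have hcS : Continuous fun z : E => softMax (fun i => inner ℝ (a i) z) :=
    continuous_softMax.comp (by fun_prop)
  have hcp : ∀ i, Continuous fun z : E => softMaxWeight i (fun i => inner ℝ (a i) z) :=
    fun i => (continuous_softMaxWeight i).comp (by fun_prop)
  have habs : ∀ z, |softMaxWeight i (fun i => inner ℝ (a i) z) *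
      softMax (fun i => inner ℝ (a i) z)| ≤ M * (1 + ‖z‖) := by
    intro z
    rw [abs_of_nonneg (mul_nonneg (softMaxWeight_pos _ _).le (by linarith [h1 z]))]
    exact (mul_le_of_le_one_left (by linarith [h1 z]) (softMaxWeight_le_one _ _)).trans (hM z)
  have hM0 : 0 ≤ M := by
    have h := (h1 0).trans (hM 0)
    simp only [norm_zero, add_zero, mul_one] at h
    linarith
  rw [integral_inner_mul_stdGaussian c
    (hf := fun z => hasFDerivAt_softMaxWeight_mul_inner a i z)]
  · simp
  · refine integrable_stdGaussian_of_le_sq (C := M) (by fun_prop) fun z => ?_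
    refine (habs z).trans (mul_le_mul_of_nonneg_left ?_ hM0)
    nlinarith [norm_nonneg z]
  · refine integrable_stdGaussian_of_le_sq (C := M) (by fun_prop) fun z => ?_
    rw [abs_mul, abs_norm]
    have := mul_le_mul_of_nonneg_left (habs z) (norm_nonneg z)
    nlinarith [norm_nonneg z, mul_nonneg hM0 (norm_nonneg z)]
  · intro v
    simp only [add_apply, smul_apply, sum_apply, smul_eq_mul, innerSL_apply_apply]
    refine integrable_stdGaussian_of_le_sq (C := M * ‖a i‖ * ‖v‖ + M * (∑ j, ‖a j‖ * ‖v‖))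
      (by fun_prop) fun z => ?_
    refine (abs_add_le _ _).trans ?_
    have e1 : (1 + ‖z‖) ≤ (1 + ‖z‖) ^ 2 := by nlinarith [norm_nonneg z]
    have e2 := abs_real_inner_le_norm (a i) v
    have e3 : |∑ j, softMaxWeight j (fun i => inner ℝ (a i) z) * inner ℝ (a j) v| ≤
        ∑ j, ‖a j‖ * ‖v‖ := by
      refine (Finset.abs_sum_le_sum_abs _ _).trans (Finset.sum_le_sum fun j _ => ?_)
      rw [abs_mul, abs_of_pos (softMaxWeight_pos _ _)]
      exact (mul_le_of_le_one_left (abs_nonneg _) (softMaxWeight_le_one _ _)).trans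
        (abs_real_inner_le_norm _ _)
    have e4 : |softMaxWeight i (fun i => inner ℝ (a i) z) *
        (1 - softMax (fun i => inner ℝ (a i) z))| ≤ M * (1 + ‖z‖) := by
      rw [abs_mul, abs_of_pos (softMaxWeight_pos _ _), abs_of_nonpos (by linarith [h1 z])]
      exact (mul_le_of_le_one_left (by linarith [h1 z]) (softMaxWeight_le_one _ _)).trans
        (by linarith [hM z])
    have e5 : M * (1 + ‖z‖) ≤ M * (1 + ‖z‖) ^ 2 := mul_le_mul_of_nonneg_left e1 hM0
    rw [abs_mul _ (inner ℝ (a i) v), abs_mul _ (∑ j, _)]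
    calc _ ≤ M * (1 + ‖z‖) ^ 2 * (‖a i‖ * ‖v‖) + M * (1 + ‖z‖) ^ 2 * (∑ j, ‖a j‖ * ‖v‖) := by
          refine add_le_add
            (mul_le_mul ((habs z).trans e5) e2 (abs_nonneg _) (by positivity))
            (mul_le_mul (e4.trans e5) e3 (abs_nonneg _) (by positivity))
      _ = _ := by ring

end

/-! ### Slepian-type comparison for the squared soft maximum. -/

section

variable {ι : Type*} [Fintype ι] {E : Type*} [NormedAddCommGroup E] [InnerProductSpace ℝ E]

/-- The derivative of the expected squared soft maximum along a rotation is non-negative. -/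
theorem integral_softMax_rotation_deriv_nonneg [FiniteDimensional ℝ E] [MeasurableSpace E]
    [BorelSpace E] (c c' : ι → E)
    (hdiag : ∀ i, inner ℝ (c i) (c' i) = 0) (hoff : ∀ i j, inner ℝ (c i) (c' j) ≤ 0) :
    0 ≤ ∫ z, 2 * softMax (fun i => inner ℝ (c i) z) *
      ∑ i, softMaxWeight i (fun i => inner ℝ (c i) z) * inner ℝ (c' i) z ∂(stdGaussian E) := by
  have hcS : Continuous fun z : E => softMax (fun i => inner ℝ (c i) z) :=
    continuous_softMax.comp (by fun_prop)
  have hcp : ∀ i, Continuous fun z : E => softMaxWeight i (fun i => inner ℝ (c i) z) :=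
    fun i => (continuous_softMaxWeight i).comp (by fun_prop)
  set K := ∑ i, ‖c i‖
  have hM := softMax_inner_le (a := c) (K := K) (Finset.sum_nonneg fun i _ => norm_nonneg _)
    fun i => Finset.single_le_sum (f := fun i => ‖c i‖) (fun i _ => norm_nonneg _)
      (Finset.mem_univ i)
  set M := Real.log (Real.exp 1 + Fintype.card ι) + K
  have hint : ∀ i, Integrable (fun z => inner ℝ (c' i) z *
      (softMaxWeight i (fun i => inner ℝ (c i) z) * softMax (fun i => inner ℝ (c i) z)))
      (stdGaussian E) := by
    intro i
    refine integrable_stdGaussian_of_le_sq (C := ‖c' i‖ * M) (by fun_prop) fun z => ?_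
    have h1 := one_le_softMax (fun i => inner ℝ (c i) z)
    have e1 : softMaxWeight i (fun i => inner ℝ (c i) z) * softMax (fun i => inner ℝ (c i) z) ≤
        M * (1 + ‖z‖) :=
      (mul_le_of_le_one_left (by linarith) (softMaxWeight_le_one _ _)).trans (hM z)
    have e0 : 0 ≤ softMaxWeight i (fun i => inner ℝ (c i) z) *
        softMax (fun i => inner ℝ (c i) z) :=
      mul_nonneg (softMaxWeight_pos _ _).le (by linarith)
    have e2 : |inner ℝ (c' i) z| ≤ ‖c' i‖ * (1 + ‖z‖) :=
      (abs_real_inner_le_norm _ _).trans (by nlinarith [norm_nonneg z, norm_nonneg (c' i)])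
    rw [abs_mul, abs_of_nonneg e0]
    calc _ ≤ (‖c' i‖ * (1 + ‖z‖)) * (M * (1 + ‖z‖)) :=
          mul_le_mul e2 e1 e0 (by positivity)
      _ = _ := by ring
  have heq : ∀ z : E, 2 * softMax (fun i => inner ℝ (c i) z) *
      ∑ i, softMaxWeight i (fun i => inner ℝ (c i) z) * inner ℝ (c' i) z =
      2 * ∑ i, inner ℝ (c' i) z *
        (softMaxWeight i (fun i => inner ℝ (c i) z) * softMax (fun i => inner ℝ (c i) z)) := by
    intro z
    rw [mul_assoc, Finset.mul_sum]
    congr 1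
    exact Finset.sum_congr rfl fun i _ => by ring
  simp only [heq]
  rw [integral_const_mul, integral_finsetSum _ fun i _ => hint i]
  refine mul_nonneg zero_le_two (Finset.sum_nonneg fun i _ => ?_)
  rw [integral_inner_mul_softMaxWeight_mul c (c' i) i]
  refine integral_nonneg fun z => ?_
  simp only [hdiag i, mul_zero, zero_add, Pi.zero_apply]
  have h1 := one_le_softMax (fun i => inner ℝ (c i) z)
  -- The diagonal term has dropped out. What remains is a product of p_i(1 - S) ≤ 0 with a weighted
  -- sum of the non-positive products ⟨c_j, c'_i⟩.
  exact mul_nonneg_of_nonpos_of_nonpos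
    (mul_nonpos_of_nonneg_of_nonpos (softMaxWeight_pos _ _).le (by linarith))
    (Finset.sum_nonpos fun j _ =>
      mul_nonpos_of_nonneg_of_nonpos (softMaxWeight_pos _ _).le (hoff j i))

/-- A Slepian-type comparison inequality for the squared soft maximum of two Gaussian families with
equal variances. -/
theorem integral_softMax_sq_le [FiniteDimensional ℝ E] [MeasurableSpace E] [BorelSpace E]
    {a b : ι → E} (hab : ∀ i j, inner ℝ (a i) (b j) = 0)
    (hdiag : ∀ i, inner ℝ (b i) (b i) = inner ℝ (a i) (a i))
    (hoff : ∀ i j, inner ℝ (b i) (b j) ≤ inner ℝ (a i) (a j)) :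
    ∫ z, softMax (fun i => inner ℝ (a i) z) ^ 2 ∂(stdGaussian E) ≤
      ∫ z, softMax (fun i => inner ℝ (b i) z) ^ 2 ∂(stdGaussian E) := by
  set K := ∑ i, (‖a i‖ + ‖b i‖)
  have hK0 : 0 ≤ K := Finset.sum_nonneg fun i _ => by positivity
  have habK : ∀ i, ‖a i‖ + ‖b i‖ ≤ K := fun i =>
    Finset.single_le_sum (f := fun i => ‖a i‖ + ‖b i‖) (fun i _ => by positivity)
      (Finset.mem_univ i)
  have hcomb : ∀ s t : ℝ, |s| ≤ 1 → |t| ≤ 1 → ∀ i, ‖s • a i + t • b i‖ ≤ K := by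
    intro s t hs ht i
    refine (norm_add_le _ _).trans (le_trans ?_ (habK i))
    rw [norm_smul, norm_smul]
    exact add_le_add (mul_le_of_le_one_left (norm_nonneg _) hs)
      (mul_le_of_le_one_left (norm_nonneg _) ht)
  -- The interpolation rotates from `a` at θ = 0 to `b` at θ = π/2, and `c'` is its θ-derivative.
  -- The orthogonality `hab` plays the role of independence of the two families.
  obtain ⟨c, hcdef⟩ : ∃ c : ℝ → ι → E, ∀ θ i, c θ i = Real.cos θ • a i + Real.sin θ • b i :=
    ⟨_, fun _ _ => rfl⟩
  set c' : ℝ → ι → E := fun θ i => (-Real.sin θ) • a i + Real.cos θ • b i with hc'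
  have hcK : ∀ θ i, ‖c θ i‖ ≤ K := fun θ i => hcdef θ i ▸
    hcomb _ _ (Real.abs_cos_le_one θ) (Real.abs_sin_le_one θ) i
  have hcK' : ∀ θ i, ‖c' θ i‖ ≤ K := fun θ =>
    hcomb _ _ (by rw [abs_neg]; exact Real.abs_sin_le_one θ) (Real.abs_cos_le_one θ)
  have hinner : ∀ θ i j, inner ℝ (c θ i) (c' θ j) =
      Real.sin θ * Real.cos θ * (inner ℝ (b i) (b j) - inner ℝ (a i) (a j)) := by
    intro θ i j
    have hba : inner ℝ (b i) (a j) = 0 := by rw [real_inner_comm, hab]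
    simp only [hcdef, hc', inner_add_left, inner_add_right, real_inner_smul_left,
      real_inner_smul_right, hab, hba]
    ring
  have hder : ∀ θ z, HasDerivAt (fun θ => softMax (fun i => inner ℝ (c θ i) z) ^ 2)
      (2 * softMax (fun i => inner ℝ (c θ i) z) *
        ∑ i, softMaxWeight i (fun i => inner ℝ (c θ i) z) * inner ℝ (c' θ i) z) θ := by
    intro θ z
    have h1 : HasDerivAt (fun θ => fun i => inner ℝ (c θ i) z)
        (fun i => inner ℝ (c' θ i) z) θ := by
      refine hasDerivAt_pi.2 fun i => ?_
      have h2 := ((Real.hasDerivAt_cos θ).mul_const (inner ℝ (a i) z)).add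
        ((Real.hasDerivAt_sin θ).mul_const (inner ℝ (b i) z))
      convert! h2 using 1
      · ext θ
        simp [hcdef, inner_add_left, real_inner_smul_left]
      · simp [hc', inner_add_left, real_inner_smul_left]
    have h3 := ((hasFDerivAt_softMax (fun i => inner ℝ (c θ i) z)).comp_hasDerivAt θ h1).pow 2
    convert! h3 using 1
    simp [sum_apply]
  set M := Real.log (Real.exp 1 + Fintype.card ι) + K
  have hM : ∀ θ z, softMax (fun i => inner ℝ (c θ i) z) ≤ M * (1 + ‖z‖) := fun θ =>
    softMax_inner_le hK0 (hcK θ)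
  have hcS : ∀ θ, Continuous fun z : E => softMax (fun i => inner ℝ (c θ i) z) :=
    fun θ => continuous_softMax.comp (by fun_prop)
  have hcp : ∀ θ i, Continuous fun z : E => softMaxWeight i (fun i => inner ℝ (c θ i) z) :=
    fun θ i => (continuous_softMaxWeight i).comp (by fun_prop)
  have hφ : ∀ θ, HasDerivAt
      (fun θ => ∫ z, softMax (fun i => inner ℝ (c θ i) z) ^ 2 ∂(stdGaussian E))
      (∫ z, 2 * softMax (fun i => inner ℝ (c θ i) z) *
        ∑ i, softMaxWeight i (fun i => inner ℝ (c θ i) z) * inner ℝ (c' θ i) z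
        ∂(stdGaussian E)) θ := by
    intro θ
    -- A quadratic bound uniform in the angle, which allows differentiation under the integral.
    have hb : ∀ η (z : E), |2 * softMax (fun i => inner ℝ (c η i) z) *
        ∑ i, softMaxWeight i (fun i => inner ℝ (c η i) z) * inner ℝ (c' η i) z| ≤
        2 * M * (Fintype.card ι * K) * (1 + ‖z‖) ^ 2 := by
      intro η z
      have h1 := one_le_softMax (fun i => inner ℝ (c η i) z)
      have h2 : |∑ i, softMaxWeight i (fun i => inner ℝ (c η i) z) * inner ℝ (c' η i) z| ≤
          Fintype.card ι * K * (1 + ‖z‖) := by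
        refine (Finset.abs_sum_le_sum_abs _ _).trans ?_
        have : ∀ i ∈ Finset.univ, |softMaxWeight i (fun i => inner ℝ (c η i) z) *
            inner ℝ (c' η i) z| ≤ K * (1 + ‖z‖) := by
          intro i _
          rw [abs_mul, abs_of_pos (softMaxWeight_pos _ _)]
          refine (mul_le_of_le_one_left (abs_nonneg _) (softMaxWeight_le_one _ _)).trans ?_
          refine (abs_real_inner_le_norm _ _).trans ?_
          have := mul_le_mul_of_nonneg_right (hcK' η i) (norm_nonneg z)
          linarith
        refine (Finset.sum_le_sum this).trans (le_of_eq ?_)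
        simp
        ring
      rw [abs_mul, abs_of_pos (by linarith)]
      calc _ ≤ 2 * (M * (1 + ‖z‖)) * (Fintype.card ι * K * (1 + ‖z‖)) :=
            mul_le_mul (by linarith [hM η z]) h2 (abs_nonneg _) (by linarith [hM η z])
        _ = _ := by ring
    refine (hasDerivAt_integral_of_dominated_loc_of_deriv_le (s := Set.univ)
      (bound := fun z => 2 * M * (Fintype.card ι * K) * (1 + ‖z‖) ^ 2) Filter.univ_mem
      (Filter.Eventually.of_forall fun η => ?_) ?_ ?_
      (Filter.Eventually.of_forall fun z η _ => hb η z) ?_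
      (Filter.Eventually.of_forall fun z η _ => hder η z)).2
    · exact ((hcS η).pow 2).aestronglyMeasurable
    · refine integrable_stdGaussian_of_le_sq (C := M ^ 2) ((hcS θ).pow 2) fun z => ?_
      have h1 := one_le_softMax (fun i => inner ℝ (c θ i) z)
      rw [abs_of_nonneg (by positivity), ← mul_pow]
      exact pow_le_pow_left₀ (by linarith) (hM θ z) 2
    · have := hcS θ
      have := hcp θ
      exact Continuous.aestronglyMeasurable (by fun_prop)
    · refine integrable_stdGaussian_of_le_sq (C := |2 * M * (Fintype.card ι * K)|)
        (by fun_prop) fun z => ?_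
      rw [abs_mul, abs_of_nonneg (by positivity : 0 ≤ (1 + ‖z‖) ^ 2)]
  have hmono : MonotoneOn
      (fun θ => ∫ z, softMax (fun i => inner ℝ (c θ i) z) ^ 2 ∂(stdGaussian E))
      (Set.Icc 0 (Real.pi / 2)) := by
    refine monotoneOn_of_deriv_nonneg (convex_Icc _ _)
      (fun θ _ => (hφ θ).continuousAt.continuousWithinAt)
      (fun θ _ => (hφ θ).differentiableAt.differentiableWithinAt) fun θ hθ => ?_
    rw [interior_Icc] at hθ
    rw [(hφ θ).deriv]
    have hs : 0 ≤ Real.sin θ * Real.cos θ :=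
      mul_nonneg (Real.sin_nonneg_of_nonneg_of_le_pi hθ.1.le (by linarith [hθ.2, Real.pi_pos]))
        (Real.cos_nonneg_of_neg_pi_div_two_le_of_le (by linarith [hθ.1, Real.pi_pos]) hθ.2.le)
    refine integral_softMax_rotation_deriv_nonneg _ _ (fun i => ?_) fun i j => ?_
    · rw [hinner, hdiag, sub_self, mul_zero]
    · rw [hinner]
      exact mul_nonpos_of_nonneg_of_nonpos hs (sub_nonpos.2 (hoff i j))
  have h := hmono ⟨le_rfl, by positivity⟩ ⟨by positivity, le_rfl⟩
    (by positivity : (0 : ℝ) ≤ Real.pi / 2)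
  simpa [hcdef] using h

end

/-! ### Transport and second moments of standard Gaussian measures. -/

section

variable {E F : Type*} [NormedAddCommGroup E] [InnerProductSpace ℝ E] [FiniteDimensional ℝ E]
  [MeasurableSpace E] [BorelSpace E] [NormedAddCommGroup F] [InnerProductSpace ℝ F]
  [FiniteDimensional ℝ F] [MeasurableSpace F] [BorelSpace F]

/-- The characteristic function of the image at t is that of the source at `g t`, and it depends
only on the norm. Here `g` acts as an isometric adjoint of `f`, so this covers rotations, sign
changes and coordinate projections. -/
theorem measurePreserving_stdGaussian {f : E → F} (hf : Continuous f) {g : F → E}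
    (hfg : ∀ x t, inner ℝ (f x) t = inner ℝ x (g t)) (hg : ∀ t, ‖g t‖ = ‖t‖) :
    MeasurePreserving f (stdGaussian E) (stdGaussian F) := by
  refine ⟨hf.measurable, ?_⟩
  have := Measure.isProbabilityMeasure_map (μ := stdGaussian E) hf.measurable.aemeasurable
  refine Measure.ext_of_charFun (funext fun t => ?_)
  rw [charFun_stdGaussian, ← hg, ← charFun_stdGaussian, charFun_apply, charFun_apply,
    integral_map hf.measurable.aemeasurable (Continuous.aestronglyMeasurable (by fun_prop))]
  simp only [hfg]

theorem integral_inner_mul_inner_stdGaussian (u v : E) :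
    ∫ z, inner ℝ u z * inner ℝ v z ∂(stdGaussian E) = inner ℝ u v := by
  have h := integral_inner_mul_stdGaussian u (f := fun z => inner ℝ v z)
    (f' := fun _ => innerSL ℝ v) (fun z => (innerSL ℝ v).hasFDerivAt)
    (integrable_stdGaussian_of_le_sq (C := ‖v‖) (by fun_prop) fun z => by
      refine (abs_real_inner_le_norm _ _).trans ?_
      gcongr
      nlinarith [norm_nonneg z])
    (integrable_stdGaussian_of_le_sq (C := ‖v‖) (by fun_prop) fun z => by
      rw [abs_mul, abs_norm]
      have := mul_le_mul_of_nonneg_left (abs_real_inner_le_norm v z) (norm_nonneg z)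
      nlinarith [norm_nonneg z, norm_nonneg v, mul_nonneg (norm_nonneg z) (norm_nonneg v)])
    (fun w => integrable_const _)
  rw [h]
  simp [real_inner_comm]

theorem integrable_inner_mul_inner_stdGaussian (u v : E) :
    Integrable (fun z => inner ℝ u z * inner ℝ v z) (stdGaussian E) := by
  refine integrable_stdGaussian_of_le_sq (C := ‖u‖ * ‖v‖) (by fun_prop) fun z => ?_
  rw [abs_mul]
  calc _ ≤ (‖u‖ * ‖z‖) * (‖v‖ * ‖z‖) :=
        mul_le_mul (abs_real_inner_le_norm _ _) (abs_real_inner_le_norm _ _) (abs_nonneg _)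
          (by positivity)
    _ = ‖u‖ * ‖v‖ * ‖z‖ ^ 2 := by ring
    _ ≤ _ := by gcongr; linarith

end

section

variable {κ κ' : Type*} [Fintype κ] [Fintype κ']

theorem integral_eval_sq_stdGaussian (k : κ) :
    ∫ z, z k ^ 2 ∂(stdGaussian (EuclideanSpace ℝ κ)) = 1 := by
  classical
  have h := integral_inner_mul_inner_stdGaussian (EuclideanSpace.single k (1 : ℝ))
    (EuclideanSpace.single k (1 : ℝ))
  simpa [EuclideanSpace.inner_single_left, sq] using h

theorem integrable_eval_sq_stdGaussian (k : κ) :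
    Integrable (fun z => z k ^ 2) (stdGaussian (EuclideanSpace ℝ κ)) := by
  classical
  have h := integrable_inner_mul_inner_stdGaussian (EuclideanSpace.single k (1 : ℝ))
    (EuclideanSpace.single k (1 : ℝ))
  simpa [EuclideanSpace.inner_single_left, sq] using h

theorem measurePreserving_comp_stdGaussian {f : κ' → κ} (hf : Function.Injective f) :
    MeasurePreserving (fun z : EuclideanSpace ℝ κ => WithLp.toLp 2 fun j => z (f j))
      (stdGaussian (EuclideanSpace ℝ κ)) (stdGaussian (EuclideanSpace ℝ κ')) := by
  refine measurePreserving_stdGaussian (by fun_prop)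
    (g := fun t => WithLp.toLp 2 (Function.extend f t 0)) (fun x t => ?_) fun t => ?_
  · simp only [PiLp.inner_apply]
    refine Fintype.sum_of_injective f hf _ _ (fun k hk => ?_) fun j => ?_
    · simp [Function.extend_apply' _ _ _ hk]
    · simp [hf.extend_apply]
  · rw [EuclideanSpace.norm_eq, EuclideanSpace.norm_eq]
    congr 1
    refine (Fintype.sum_of_injective f hf _ _ (fun k hk => ?_) fun j => ?_).symm
    · simp [Function.extend_apply' _ _ _ hk]
    · simp [hf.extend_apply]

theorem measurePreserving_sign_stdGaussian {ε : κ → ℝ} (hε : ∀ k, |ε k| = 1) :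
    MeasurePreserving (fun z : EuclideanSpace ℝ κ => WithLp.toLp 2 fun k => ε k * z k)
      (stdGaussian (EuclideanSpace ℝ κ)) (stdGaussian (EuclideanSpace ℝ κ)) := by
  refine measurePreserving_stdGaussian (by fun_prop)
    (g := fun z => WithLp.toLp 2 fun k => ε k * z k) (fun x t => ?_) fun t => ?_
  · simp only [PiLp.inner_apply]
    refine Finset.sum_congr rfl fun k _ => ?_
    simp
    ring
  · simp [EuclideanSpace.norm_eq, hε]

/-- A function that is odd under a sign change of coordinates has mean zero. -/
theorem integral_eq_zero_of_sign {ε : κ → ℝ} (hε : ∀ k, |ε k| = 1) {f : EuclideanSpace ℝ κ → ℝ}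
    (hf : Continuous f) (hodd : ∀ z, f (WithLp.toLp 2 fun k => ε k * z k) = -f z) :
    ∫ z, f z ∂(stdGaussian (EuclideanSpace ℝ κ)) = 0 := by
  have hmp := measurePreserving_sign_stdGaussian hε
  have h := integral_map (μ := stdGaussian (EuclideanSpace ℝ κ)) hmp.measurable.aemeasurable
    (f := f) hf.aestronglyMeasurable
  rw [hmp.map_eq] at h
  simp only [hodd, integral_neg] at h
  linarith

end

/-! ### Finite nets for the operator norm. -/

section

variable {W : Type*} [NormedAddCommGroup W] [InnerProductSpace ℝ W]

theorem exists_unit_le_inner [Nontrivial W] (A : W →L[ℝ] W) {ε : ℝ} (hε : 0 < ε) :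
    ∃ u v : W, ‖u‖ = 1 ∧ ‖v‖ = 1 ∧ (1 - ε) * ‖A‖ ≤ inner ℝ u (A v) := by
  by_cases hA : A = 0
  · obtain ⟨u, hu⟩ := exists_norm_eq W zero_le_one
    exact ⟨u, u, hu, hu, by simp [hA]⟩
  have hA' : 0 < ‖A‖ := norm_pos_iff.2 hA
  -- The maximum with 0 forces A x ≠ 0 even when ε ≥ 1, so that A x can be normalised.
  obtain ⟨x, hx1, hx2⟩ := A.exists_lt_apply_of_lt_opNorm (r := max 0 ((1 - ε) * ‖A‖))
    (max_lt hA' (by nlinarith))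
  have hx2' := (le_max_left _ _).trans_lt hx2
  have hx3 := (le_max_right _ _).trans_lt hx2
  have hx0 : x ≠ 0 := by rintro rfl; simp at hx2'
  have hxn : 0 < ‖x‖ := norm_pos_iff.2 hx0
  refine ⟨‖A x‖⁻¹ • A x, ‖x‖⁻¹ • x, ?_, ?_, ?_⟩
  · rw [norm_smul, norm_inv, norm_norm, inv_mul_cancel₀ hx2'.ne']
  · rw [norm_smul, norm_inv, norm_norm, inv_mul_cancel₀ hxn.ne']
  · rw [map_smul, real_inner_smul_left, real_inner_smul_right, real_inner_self_eq_norm_sq]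
    have : ‖A x‖⁻¹ * (‖x‖⁻¹ * ‖A x‖ ^ 2) = ‖x‖⁻¹ * ‖A x‖ := by field_simp
    rw [this]
    exact hx3.le.trans (le_mul_of_one_le_left hx2'.le ((one_le_inv₀ hxn).2 hx1.le))

/-- A finite net of pairs of unit vectors that nearly attains every operator norm. -/
theorem exists_finset_le_inner [FiniteDimensional ℝ W] [Nontrivial W] {ε : ℝ} (hε : 0 < ε) :
    ∃ T : Finset (W × W), (∀ p ∈ T, ‖p.1‖ = 1 ∧ ‖p.2‖ = 1) ∧
      ∀ A : W →L[ℝ] W, ∃ p ∈ T, (1 - 3 * ε) * ‖A‖ ≤ inner ℝ p.1 (A p.2) := by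
  classical
  obtain ⟨t, hts, htf, hcov⟩ := (isCompact_sphere (0 : W) 1).finite_cover_balls hε
  lift t to Finset W using htf
  have hnear : ∀ u : W, ‖u‖ = 1 → ∃ x ∈ t, ‖u - x‖ < ε := by
    intro u hu
    have := hcov (mem_sphere_zero_iff_norm.2 hu)
    simpa [dist_eq_norm] using this
  have hunit : ∀ x ∈ t, ‖x‖ = 1 := fun x hx => mem_sphere_zero_iff_norm.1 (hts hx)
  refine ⟨t ×ˢ t, fun p hp => ?_, fun A => ?_⟩
  · rw [Finset.mem_product] at hp
    exact ⟨hunit _ hp.1, hunit _ hp.2⟩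
  · obtain ⟨u, v, hu, hv, huv⟩ := exists_unit_le_inner A hε
    obtain ⟨x, hx, hux⟩ := hnear u hu
    obtain ⟨y, hy, hvy⟩ := hnear v hv
    refine ⟨(x, y), Finset.mem_product.2 ⟨hx, hy⟩, ?_⟩
    -- The three losses of ε‖A‖ come from near-attainment, from replacing u by x, and from replacing
    -- v by y.
    have h1 : inner ℝ u (A v) = inner ℝ x (A y) + inner ℝ (u - x) (A v) +
        inner ℝ x (A (v - y)) := by
      rw [map_sub, inner_sub_left, inner_sub_right]
      ring
    have h2 : inner ℝ (u - x) (A v) ≤ ε * ‖A‖ := by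
      refine (real_inner_le_norm _ _).trans ?_
      have := A.le_opNorm v
      rw [hv, mul_one] at this
      exact mul_le_mul hux.le this (norm_nonneg _) hε.le
    have h3 : inner ℝ x (A (v - y)) ≤ ε * ‖A‖ := by
      refine (real_inner_le_norm _ _).trans ?_
      rw [hunit x hx, one_mul, mul_comm]
      exact (A.le_opNorm _).trans (mul_le_mul_of_nonneg_left hvy.le (norm_nonneg _))
    simp only
    linarith

end

/-! ### The second moment of the operator norm of a Gaussian matrix. -/

section

variable {J : Type*} [Fintype J]

/-- The family `u ⊗ v ⊕ 1`, which represents the process `⟨u, G v⟩ + g`. -/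
noncomputable def bilinearFamily (u v : EuclideanSpace ℝ J) :
    EuclideanSpace ℝ (((J × J) ⊕ Unit) ⊕ (J ⊕ J)) :=
  WithLp.toLp 2 (Sum.elim (Sum.elim (fun p => u p.1 * v p.2) fun _ => 1) 0)

/-- The family `u ⊕ v`, which represents the process `⟨g, u⟩ + ⟨h, v⟩`. -/
noncomputable def linearFamily (u v : EuclideanSpace ℝ J) :
    EuclideanSpace ℝ (((J × J) ⊕ Unit) ⊕ (J ⊕ J)) :=
  WithLp.toLp 2 (Sum.elim 0 (Sum.elim u v))

theorem inner_bilinearFamily (u v u' v' : EuclideanSpace ℝ J) :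
    inner ℝ (bilinearFamily u v) (bilinearFamily u' v') = inner ℝ u u' * inner ℝ v v' + 1 := by
  simp only [PiLp.inner_apply, bilinearFamily, Fintype.sum_sum_type, Sum.elim_inl, Sum.elim_inr,
    Fintype.sum_prod_type, RCLike.inner_apply, conj_trivial, Finset.sum_mul_sum]
  simp
  exact Finset.sum_congr rfl fun i _ => Finset.sum_congr rfl fun j _ => by ring

theorem inner_linearFamily (u v u' v' : EuclideanSpace ℝ J) :
    inner ℝ (linearFamily u v) (linearFamily u' v') = inner ℝ u u' + inner ℝ v v' := by
  simp [PiLp.inner_apply, linearFamily, Fintype.sum_sum_type]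

theorem inner_bilinearFamily_linearFamily (u v u' v' : EuclideanSpace ℝ J) :
    inner ℝ (bilinearFamily u v) (linearFamily u' v') = 0 := by
  simp [PiLp.inner_apply, bilinearFamily, linearFamily, Fintype.sum_sum_type]

/-- For unit vectors both processes have variance 2 before scaling by β. Their covariances differ by
1 + ⟨u,u'⟩⟨v,v'⟩ - ⟨u,u'⟩ - ⟨v,v'⟩ = (1 - ⟨u,u'⟩)(1 - ⟨v,v'⟩) ≥ 0. The additional scalar Gaussian in
the bilinear process is what equalises the variances. -/
theorem integral_softMax_bilinearFamily_sq_le (T : Finset (EuclideanSpace ℝ J × EuclideanSpace ℝ J))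
    (hT : ∀ p ∈ T, ‖p.1‖ = 1 ∧ ‖p.2‖ = 1) (β : ℝ) :
    ∫ z, softMax (fun p : T => β * inner ℝ (bilinearFamily p.1.1 p.1.2) z) ^ 2
        ∂(stdGaussian (EuclideanSpace ℝ (((J × J) ⊕ Unit) ⊕ (J ⊕ J)))) ≤
      ∫ z, softMax (fun p : T => β * inner ℝ (linearFamily p.1.1 p.1.2) z) ^ 2
        ∂(stdGaussian (EuclideanSpace ℝ (((J × J) ⊕ Unit) ⊕ (J ⊕ J)))) := by
  simp only [← real_inner_smul_left]
  refine integral_softMax_sq_le (fun p q => ?_) (fun p => ?_) fun p q => ?_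
  · simp [real_inner_smul_left, real_inner_smul_right, inner_bilinearFamily_linearFamily]
  · simp only [real_inner_smul_left, real_inner_smul_right, inner_bilinearFamily,
      inner_linearFamily]
    simp only [real_inner_self_eq_norm_sq, (hT _ p.2).1, (hT _ p.2).2]
    ring
  · simp only [real_inner_smul_left, real_inner_smul_right, inner_bilinearFamily,
      inner_linearFamily]
    have h1 := real_inner_le_norm p.1.1 q.1.1
    have h2 := real_inner_le_norm p.1.2 q.1.2
    rw [(hT _ p.2).1, (hT _ q.2).1, one_mul] at h1
    rw [(hT _ p.2).2, (hT _ q.2).2, one_mul] at h2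
    rw [← mul_assoc, ← mul_assoc]
    refine mul_le_mul_of_nonneg_left ?_ (mul_self_nonneg β)
    nlinarith [mul_nonneg (sub_nonneg.2 h1) (sub_nonneg.2 h2)]

/-- Keeping a² + 2ag instead of the square of the positive part of a + g makes the auxiliary g
disappear on integration. If a + g ≤ 0, the left side is non-positive. -/
theorem sq_add_two_mul_le_softMax_sq {ι : Type*} [Fintype ι] {x : ι → ℝ} {a g β : ℝ}
    (ha : 0 ≤ a) (hβ : 0 ≤ β) (i : ι) (hi : β * (a + g) ≤ x i) :
    β ^ 2 * (a ^ 2 + 2 * (a * g)) ≤ softMax x ^ 2 := by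
  have h1 := one_le_softMax x
  have h2 := hi.trans (le_softMax x i)
  rcases le_total 0 (a + g) with h | h
  · calc β ^ 2 * (a ^ 2 + 2 * (a * g)) ≤ (β * (a + g)) ^ 2 := by
          nlinarith [mul_nonneg (sq_nonneg β) (sq_nonneg g)]
      _ ≤ _ := pow_le_pow_left₀ (mul_nonneg hβ h) h2 2
  · have h3 : a ^ 2 + 2 * (a * g) ≤ 0 := by nlinarith
    nlinarith [mul_nonneg (sq_nonneg β) (neg_nonneg.2 h3), sq_nonneg (softMax x)]

theorem add_sq_le_of_pos {L x δ : ℝ} (hδ : 0 < δ) :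
    (L + x) ^ 2 ≤ (1 + δ) * x ^ 2 + (1 + 1 / δ) * L ^ 2 := by
  have h : (1 + δ) * x ^ 2 + (1 + 1 / δ) * L ^ 2 - (L + x) ^ 2 = (δ * x - L) ^ 2 / δ := by
    field_simp
    ring
  have : 0 ≤ (δ * x - L) ^ 2 / δ := by positivity
  linarith

theorem softMax_linearFamily_sq_le (T : Finset (EuclideanSpace ℝ J × EuclideanSpace ℝ J))
    (hT : ∀ p ∈ T, ‖p.1‖ = 1 ∧ ‖p.2‖ = 1) {β δ : ℝ} (hβ : 0 ≤ β) (hδ : 0 < δ)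
    (z : EuclideanSpace ℝ (((J × J) ⊕ Unit) ⊕ (J ⊕ J))) :
    softMax (fun p : T => β * inner ℝ (linearFamily p.1.1 p.1.2) z) ^ 2 ≤
      2 * (1 + δ) * β ^ 2 * (∑ j, z (Sum.inr (Sum.inl j)) ^ 2 + ∑ j, z (Sum.inr (Sum.inr j)) ^ 2) +
        (1 + 1 / δ) * Real.log (Real.exp 1 + Fintype.card T) ^ 2 := by
  set g : EuclideanSpace ℝ J := WithLp.toLp 2 fun j => z (Sum.inr (Sum.inl j)) with hg
  set h : EuclideanSpace ℝ J := WithLp.toLp 2 fun j => z (Sum.inr (Sum.inr j)) with hh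
  have hgn : ∑ j, z (Sum.inr (Sum.inl j)) ^ 2 = ‖g‖ ^ 2 := by
    rw [EuclideanSpace.real_norm_sq_eq]
  have hhn : ∑ j, z (Sum.inr (Sum.inr j)) ^ 2 = ‖h‖ ^ 2 := by
    rw [EuclideanSpace.real_norm_sq_eq]
  have hin : ∀ p : T, inner ℝ (linearFamily p.1.1 p.1.2) z = inner ℝ p.1.1 g + inner ℝ p.1.2 h := by
    intro p
    simp [PiLp.inner_apply, linearFamily, Fintype.sum_sum_type, hg, hh]
  have hle : softMax (fun p : T => β * inner ℝ (linearFamily p.1.1 p.1.2) z) ≤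
      Real.log (Real.exp 1 + Fintype.card T) + β * (‖g‖ + ‖h‖) := by
    refine softMax_le (by positivity) fun p => mul_le_mul_of_nonneg_left ?_ hβ
    rw [hin]
    have h1 := real_inner_le_norm p.1.1 g
    have h2 := real_inner_le_norm p.1.2 h
    rw [(hT _ p.2).1, one_mul] at h1
    rw [(hT _ p.2).2, one_mul] at h2
    exact add_le_add h1 h2
  have h1 := one_le_softMax (fun p : T => β * inner ℝ (linearFamily p.1.1 p.1.2) z)
  rw [hgn, hhn]
  refine (pow_le_pow_left₀ (by linarith) hle 2).trans ((add_sq_le_of_pos hδ).trans ?_)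
  have h3 : (‖g‖ + ‖h‖) ^ 2 ≤ 2 * (‖g‖ ^ 2 + ‖h‖ ^ 2) := add_sq_le
  have h4 := mul_le_mul_of_nonneg_left h3 (by positivity : 0 ≤ (1 + δ) * β ^ 2)
  rw [mul_pow]
  linarith

variable [DecidableEq J]

/-- The operator on `ℝ^J` whose matrix is a `J × J` array. -/
noncomputable def arrayOp :
    EuclideanSpace ℝ (J × J) →L[ℝ] EuclideanSpace ℝ J →L[ℝ] EuclideanSpace ℝ J :=
  LinearMap.toContinuousLinearMap
    { toFun := fun G => Matrix.toEuclideanCLM (𝕜 := ℝ) (Matrix.of fun i j => G (i, j))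
      map_add' := fun G H => by
        rw [← map_add]
        rfl
      map_smul' := fun a G => by
        rw [RingHom.id_apply, ← map_smul]
        rfl }

theorem arrayOp_apply (G : EuclideanSpace ℝ (J × J)) (v : EuclideanSpace ℝ J) (i : J) :
    arrayOp G v i = ∑ j, G (i, j) * v j := rfl

theorem inner_arrayOp (G : EuclideanSpace ℝ (J × J)) (u v : EuclideanSpace ℝ J) :
    inner ℝ u (arrayOp G v) = ∑ p : J × J, u p.1 * v p.2 * G p := by
  rw [Fintype.sum_prod_type]
  simp only [PiLp.inner_apply, arrayOp_apply]
  refine Finset.sum_congr rfl fun i _ => ?_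
  simp only [RCLike.inner_apply, conj_trivial, Finset.sum_mul]
  exact Finset.sum_congr rfl fun j _ => by ring

theorem integrable_arrayOp_sq :
    Integrable (fun G : EuclideanSpace ℝ (J × J) => ‖arrayOp G‖ ^ 2) (stdGaussian (EuclideanSpace ℝ (J × J))) := by
  refine integrable_stdGaussian_of_le_sq (C := ‖arrayOp (J := J)‖ ^ 2) (by fun_prop) fun G => ?_
  rw [abs_of_nonneg (by positivity), ← mul_pow]
  gcongr
  exact (ContinuousLinearMap.le_opNorm _ _).trans
    (mul_le_mul_of_nonneg_left (by linarith) (norm_nonneg _))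

theorem integral_arrayOp_sq_scaled_le [Nonempty J] {ε β δ : ℝ} (hε : ε < 1 / 3) (hβ : 0 < β)
    (hδ : 0 < δ) (T : Finset (EuclideanSpace ℝ J × EuclideanSpace ℝ J))
    (hT : ∀ p ∈ T, ‖p.1‖ = 1 ∧ ‖p.2‖ = 1)
    (hnet : ∀ A : EuclideanSpace ℝ J →L[ℝ] EuclideanSpace ℝ J,
      ∃ p ∈ T, (1 - 3 * ε) * ‖A‖ ≤ inner ℝ p.1 (A p.2)) :
    β ^ 2 * ((1 - 3 * ε) ^ 2 *
      ∫ G, ‖arrayOp G‖ ^ 2 ∂(stdGaussian (EuclideanSpace ℝ (J × J)))) ≤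
      2 * (1 + δ) * β ^ 2 * (2 * Fintype.card J) +
        (1 + 1 / δ) * Real.log (Real.exp 1 + Fintype.card T) ^ 2 := by
  set γ := stdGaussian (EuclideanSpace ℝ (((J × J) ⊕ Unit) ⊕ (J ⊕ J)))
  set π : EuclideanSpace ℝ (((J × J) ⊕ Unit) ⊕ (J ⊕ J)) → EuclideanSpace ℝ (J × J) :=
    fun z => WithLp.toLp 2 fun p => z (Sum.inl (Sum.inl p)) with hπ
  have hπmp : MeasurePreserving π γ (stdGaussian (EuclideanSpace ℝ (J × J))) :=
    measurePreserving_comp_stdGaussian (f := fun p => Sum.inl (Sum.inl p))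
      (Sum.inl_injective.comp Sum.inl_injective)
  have hπc : Continuous π := by fun_prop
  set N : EuclideanSpace ℝ (((J × J) ⊕ Unit) ⊕ (J ⊕ J)) → ℝ :=
    fun z => (1 - 3 * ε) * ‖arrayOp (π z)‖ with hN
  have hNc : Continuous N := by fun_prop
  have hN0 : ∀ z, 0 ≤ N z := fun z => mul_nonneg (by linarith) (norm_nonneg _)
  have hNsq : ∫ z, N z ^ 2 ∂γ = (1 - 3 * ε) ^ 2 *
      ∫ G, ‖arrayOp G‖ ^ 2 ∂(stdGaussian (EuclideanSpace ℝ (J × J))) := by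
    rw [← hπmp.map_eq, integral_map hπmp.measurable.aemeasurable
      (Continuous.aestronglyMeasurable (by fun_prop)), ← integral_const_mul]
    simp only [hN, mul_pow]
  have hNsqi : Integrable (fun z => N z ^ 2) γ := by
    have := (hπmp.integrable_comp_of_integrable integrable_arrayOp_sq).const_mul ((1 - 3 * ε) ^ 2)
    simpa only [hN, mul_pow, Function.comp_apply] using this
  set g : EuclideanSpace ℝ (((J × J) ⊕ Unit) ⊕ (J ⊕ J)) → ℝ := fun z => z (Sum.inl (Sum.inr ()))
  have hgc : Continuous g := by fun_prop
  have hgi : Integrable (fun z => g z ^ 2) γ := integrable_eval_sq_stdGaussian _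
  have hNgi : Integrable (fun z => N z * g z) γ := by
    refine (hNsqi.add hgi).mono' (hNc.mul hgc).aestronglyMeasurable (Filter.Eventually.of_forall fun z => ?_)
    rw [Real.norm_eq_abs, abs_le, Pi.add_apply]
    constructor <;> nlinarith [sq_nonneg (N z + g z), sq_nonneg (N z - g z)]
  -- `N` does not involve the scalar coordinate `g`, so flipping its sign negates the product.
  have hNg : ∫ z, N z * g z ∂γ = 0 := by
    refine integral_eq_zero_of_sign
      (ε := Sum.elim (Sum.elim (fun _ => 1) fun _ => -1) fun _ => 1) ?_ (hNc.mul hgc) fun z => ?_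
    · rintro ((_ | _) | _) <;> simp
    · simp [hN, hπ, g]
  have hlow : ∀ z, β ^ 2 * (N z ^ 2 + 2 * (N z * g z)) ≤
      softMax (fun p : T => β * inner ℝ (bilinearFamily p.1.1 p.1.2) z) ^ 2 := by
    intro z
    obtain ⟨p, hp, hle⟩ := hnet (arrayOp (π z))
    refine sq_add_two_mul_le_softMax_sq (hN0 z) hβ.le ⟨p, hp⟩
      (mul_le_mul_of_nonneg_left ?_ hβ.le)
    rw [inner_arrayOp] at hle
    have : inner ℝ (bilinearFamily p.1 p.2) z = ∑ q : J × J, p.1 q.1 * p.2 q.2 * π z q + g z := by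
      simp [PiLp.inner_apply, bilinearFamily, Fintype.sum_sum_type, hπ, g, mul_comm]
    simp only [this]
    linarith
  have hint : ∀ a : T → EuclideanSpace ℝ (((J × J) ⊕ Unit) ⊕ (J ⊕ J)),
      Integrable (fun z => softMax (fun p => β * inner ℝ (a p) z) ^ 2) γ := by
    intro a
    simp only [← real_inner_smul_left]
    have hcS : Continuous fun z => softMax (fun p => inner ℝ (β • a p) z) :=
      continuous_softMax.comp (by fun_prop)
    have hM := softMax_inner_le (a := fun p => β • a p) (K := ∑ p, ‖β • a p‖)
      (Finset.sum_nonneg fun i _ => norm_nonneg _)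
      fun i => Finset.single_le_sum (f := fun i => ‖β • a i‖) (fun i _ => norm_nonneg _)
        (Finset.mem_univ i)
    refine integrable_stdGaussian_of_le_sq (hcS.pow 2)
      (C := (Real.log (Real.exp 1 + Fintype.card T) + ∑ p, ‖β • a p‖) ^ 2) fun z => ?_
    have h1 := one_le_softMax (fun p => inner ℝ (β • a p) z)
    rw [abs_of_nonneg (by positivity), ← mul_pow]
    exact pow_le_pow_left₀ (by linarith) (hM z) 2
  have hsumi : ∀ f : J → ((J × J) ⊕ Unit) ⊕ (J ⊕ J),
      Integrable (fun z : EuclideanSpace ℝ (((J × J) ⊕ Unit) ⊕ (J ⊕ J)) => ∑ j, z (f j) ^ 2) γ :=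
    fun f => integrable_finsetSum _ fun j _ => integrable_eval_sq_stdGaussian _
  have hsum : ∀ f : J → ((J × J) ⊕ Unit) ⊕ (J ⊕ J),
      ∫ z, (∑ j, z (f j) ^ 2) ∂γ = Fintype.card J := by
    intro f
    refine (integral_finsetSum Finset.univ fun j _ =>
      integrable_eval_sq_stdGaussian (f j)).trans ?_
    simp only [integral_eval_sq_stdGaussian]
    simp
  have hsum2 : Integrable (fun z : EuclideanSpace ℝ (((J × J) ⊕ Unit) ⊕ (J ⊕ J)) =>
      2 * (1 + δ) * β ^ 2 *
        (∑ j, z (Sum.inr (Sum.inl j)) ^ 2 + ∑ j, z (Sum.inr (Sum.inr j)) ^ 2)) γ :=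
    ((hsumi fun j => Sum.inr (Sum.inl j)).add (hsumi fun j => Sum.inr (Sum.inr j))).const_mul _
  calc _ = ∫ z, β ^ 2 * (N z ^ 2 + 2 * (N z * g z)) ∂γ := by
        rw [integral_const_mul, integral_add hNsqi (hNgi.const_mul 2), integral_const_mul, hNg,
          hNsq, mul_zero, add_zero]
    _ ≤ ∫ z, softMax (fun p : T => β * inner ℝ (bilinearFamily p.1.1 p.1.2) z) ^ 2 ∂γ :=
        integral_mono ((hNsqi.add (hNgi.const_mul 2)).const_mul _) (hint _) hlow
    _ ≤ ∫ z, softMax (fun p : T => β * inner ℝ (linearFamily p.1.1 p.1.2) z) ^ 2 ∂γ :=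
        integral_softMax_bilinearFamily_sq_le T hT β
    _ ≤ ∫ z, (2 * (1 + δ) * β ^ 2 *
          (∑ j, z (Sum.inr (Sum.inl j)) ^ 2 + ∑ j, z (Sum.inr (Sum.inr j)) ^ 2) +
          (1 + 1 / δ) * Real.log (Real.exp 1 + Fintype.card T) ^ 2) ∂γ :=
        integral_mono (hint _) (hsum2.add (integrable_const _))
          (softMax_linearFamily_sq_le T hT hβ.le hδ)
    _ = _ := by
        rw [integral_add hsum2 (integrable_const _), integral_const_mul,
          integral_add (hsumi fun j => Sum.inr (Sum.inl j)) (hsumi fun j => Sum.inr (Sum.inr j)),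
          hsum, hsum, integral_const, probReal_univ, one_smul]
        ring

/-- The second moment of the operator norm of a square standard Gaussian matrix. -/
theorem integral_arrayOp_sq_le :
    ∫ G, ‖arrayOp G‖ ^ 2 ∂(stdGaussian (EuclideanSpace ℝ (J × J))) ≤ 4 * Fintype.card J := by
  rcases isEmpty_or_nonempty J with hJ | hJ
  · have : ∀ G : EuclideanSpace ℝ (J × J), arrayOp G = 0 := fun G => Subsingleton.elim _ _
    simp [this]
  set P := ∫ G, ‖arrayOp G‖ ^ 2 ∂(stdGaussian (EuclideanSpace ℝ (J × J)))
  have step : ∀ ε : ℝ, 0 < ε → ε < 1 / 3 → (1 - 3 * ε) ^ 2 * P ≤ 4 * Fintype.card J := by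
    intro ε h0 h1
    obtain ⟨T, hT, hnet⟩ := exists_finset_le_inner (W := EuclideanSpace ℝ J) h0
    set L := Real.log (Real.exp 1 + Fintype.card T)
    have hle : ∀ t : ℝ, 0 < t → (1 - 3 * ε) ^ 2 * P ≤
        4 * (1 + t) * Fintype.card J + (t ^ 2 + t) * L ^ 2 := by
      intro t ht
      -- With β = 1/t and δ = t, multiplying by t² turns the logarithmic term into (t² + t)L². It
      -- vanishes as t → 0 with the net fixed; only afterwards does ε tend to 0.
      have := integral_arrayOp_sq_scaled_le h1 (inv_pos.2 ht) ht T hT hnet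
      have h2 := mul_le_mul_of_nonneg_left this (sq_nonneg t)
      have e1 : ∀ x : ℝ, t ^ 2 * (t⁻¹ ^ 2 * x) = x := by intro x; field_simp
      rw [e1] at h2
      refine h2.trans (le_of_eq ?_)
      field_simp
      ring
    have hlim : Filter.Tendsto (fun t : ℝ => 4 * (1 + t) * (Fintype.card J : ℝ) +
        (t ^ 2 + t) * L ^ 2) (nhdsWithin 0 (Set.Ioi 0)) (nhds (4 * (Fintype.card J : ℝ))) := by
      have : Continuous fun t : ℝ => 4 * (1 + t) * (Fintype.card J : ℝ) +
        (t ^ 2 + t) * L ^ 2 := by fun_prop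
      have h := this.tendsto 0
      simp only [add_zero, mul_one, ne_eq, OfNat.ofNat_ne_zero, not_false_eq_true, zero_pow,
        zero_mul] at h
      exact h.mono_left nhdsWithin_le_nhds
    exact ge_of_tendsto hlim (Filter.eventually_of_mem self_mem_nhdsWithin hle)
  have hlim : Filter.Tendsto (fun ε : ℝ => (1 - 3 * ε) ^ 2 * P) (nhdsWithin 0 (Set.Ioi 0))
      (nhds P) := by
    have : Continuous fun ε : ℝ => (1 - 3 * ε) ^ 2 * P := by fun_prop
    have h := this.tendsto 0
    simp only [mul_zero, sub_zero, one_pow, one_mul] at h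
    exact h.mono_left nhdsWithin_le_nhds
  exact le_of_tendsto hlim (Filter.eventually_of_mem (Ioo_mem_nhdsGT (by norm_num : (0 : ℝ) < 1 / 3))
    fun ε hε => step ε hε.1 hε.2)

end

/-! ### Upper bounds for the vector k-support norm. -/

section

variable {d : ℕ}

/-- Different pieces may share a support set; merging them by the triangle inequality does not
increase the cost. -/
theorem kSupportNorm_le_sum {k : ℕ} {w : EuclideanSpace ℝ (Fin d)} {ι : Type*} [Fintype ι]
    (h : ι → Finset (Fin d)) (hk : ∀ x, (h x).card ≤ k) (u : ι → EuclideanSpace ℝ (Fin d))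
    (hu : ∀ x, ∀ i ∉ h x, u x i = 0) (hw : ∑ x, u x = w) :
    kSupportNorm k w ≤ ∑ x, ‖u x‖ := by
  classical
  have hmaps : ∀ x ∈ Finset.univ, h x ∈ subsetsCardLE k d := fun x _ => by
    simp [subsetsCardLE, hk]
  have hbdd : BddBelow {x : ℝ | ∃ v : Finset (Fin d) → EuclideanSpace ℝ (Fin d),
      (∀ g ∈ subsetsCardLE k d, ∀ i, i ∉ g → v g i = 0) ∧
      ∑ g ∈ subsetsCardLE k d, v g = w ∧
      x = ∑ g ∈ subsetsCardLE k d, ‖v g‖} := by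
    refine ⟨0, ?_⟩
    rintro _ ⟨v, -, -, rfl⟩
    positivity
  refine (csInf_le hbdd ⟨fun g => ∑ x with h x = g, u x, ?_, ?_, rfl⟩).trans ?_
  · intro g _ i hi
    rw [WithLp.ofLp_sum, Finset.sum_apply]
    refine Finset.sum_eq_zero fun x hx => hu x i ?_
    rw [(Finset.mem_filter.1 hx).2]
    exact hi
  · rw [Finset.sum_fiberwise_of_maps_to hmaps, hw]
  · rw [← Finset.sum_fiberwise_of_maps_to hmaps fun x => ‖u x‖]
    exact Finset.sum_le_sum fun g _ => norm_sum_le _ _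

theorem exists_kSupport_decomposition {k : ℕ} (hk : 1 ≤ k) (w : EuclideanSpace ℝ (Fin d)) :
    ∃ v : Finset (Fin d) → EuclideanSpace ℝ (Fin d),
      (∀ g ∈ subsetsCardLE k d, ∀ i, i ∉ g → v g i = 0) ∧
      ∑ g ∈ subsetsCardLE k d, v g = w := by
  classical
  refine ⟨fun g => ∑ x with {x} = g, EuclideanSpace.single x (w x), fun g _ i hi => ?_, ?_⟩
  · rw [WithLp.ofLp_sum, Finset.sum_apply]
    refine Finset.sum_eq_zero fun x hx => ?_
    rw [← (Finset.mem_filter.1 hx).2, Finset.mem_singleton] at hi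
    simp [hi]
  · rw [Finset.sum_fiberwise_of_maps_to fun x _ => by simp [subsetsCardLE, hk]]
    ext i
    simp [WithLp.ofLp_sum, Finset.sum_apply]

/-- A point of the hypersimplex is a convex combination of indicators of `k`-subsets. -/
theorem exists_convex_combination_indicator {k : ℕ} (hk : 1 ≤ k) (hkd : k ≤ d) {y : Fin d → ℝ}
    (h0 : ∀ i, 0 ≤ y i) (h1 : ∀ i, y i ≤ 1) (hy : ∑ i, y i = k) :
    ∃ (c : Equiv.Perm (Fin d) → ℝ) (h : Equiv.Perm (Fin d) → Finset (Fin d)),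
      (∀ π, 0 ≤ c π) ∧ ∑ π, c π = 1 ∧ (∀ π, (h π).card = k) ∧
      ∀ i, y i = ∑ π, c π * if i ∈ h π then 1 else 0 := by
  classical
  -- The mass y_i is spread evenly over the first k columns and 1 - y_i over the others. This is
  -- doubly stochastic, and a permutation in its Birkhoff decomposition selects the k rows sent to
  -- the first k columns.
  set A : Matrix (Fin d) (Fin d) ℝ := Matrix.of fun i j =>
    if (j : ℕ) < k then y i / k else (1 - y i) / (d - k) with hA
  have hk0 : (0 : ℝ) < k := by exact_mod_cast hk
  have hcard : (Finset.univ.filter fun j : Fin d => (j : ℕ) < k).card = k := by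
    rw [Fin.card_filter_val_lt, min_eq_right hkd]
  have hcard' : ((Finset.univ.filter fun j : Fin d => ¬ (j : ℕ) < k).card : ℝ) = d - k := by
    have := Finset.card_filter_add_card_filter_not (s := (Finset.univ : Finset (Fin d)))
      (fun j : Fin d => (j : ℕ) < k)
    rw [hcard, Finset.card_univ, Fintype.card_fin] at this
    rw [eq_sub_iff_add_eq, add_comm]
    exact_mod_cast this
  have hdk : (0 : ℝ) ≤ d - k := sub_nonneg.2 (by exact_mod_cast hkd)
  have hpart : ∀ i, (∑ j ∈ Finset.univ.filter (fun j : Fin d => (j : ℕ) < k), A i j) = y i := by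
    intro i
    have : ∀ j ∈ (Finset.univ.filter fun j : Fin d => (j : ℕ) < k), A i j = y i / k := by
      intro j hj
      simp [hA, (Finset.mem_filter.1 hj).2]
    rw [Finset.sum_congr rfl this, Finset.sum_const, hcard, nsmul_eq_mul]
    field_simp
  have hmem : A ∈ doublyStochastic ℝ (Fin d) := by
    rw [mem_doublyStochastic_iff_sum]
    refine ⟨fun i j => ?_, fun i => ?_, fun j => ?_⟩
    · simp only [hA, Matrix.of_apply]
      split_ifs
      · exact div_nonneg (h0 i) hk0.le
      · exact div_nonneg (sub_nonneg.2 (h1 i)) hdk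
    · rw [← Finset.sum_filter_add_sum_filter_not _ (fun j : Fin d => (j : ℕ) < k), hpart]
      have : ∀ j ∈ (Finset.univ.filter fun j : Fin d => ¬ (j : ℕ) < k),
          A i j = (1 - y i) / (d - k) := by
        intro j hj
        simp [hA, (Finset.mem_filter.1 hj).2]
      rw [Finset.sum_congr rfl this, Finset.sum_const, nsmul_eq_mul, hcard']
      -- When d = k the second group of columns is empty, and ∑ y_i = k with y_i ≤ 1 forces every
      -- y_i = 1.
      rcases hdk.eq_or_lt with h | h
      · have hyi : ∑ i, (1 - y i) = 0 := by
          rw [Finset.sum_sub_distrib, hy]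
          simp
          linarith
        rw [← h, zero_mul, add_zero]
        have := (Finset.sum_eq_zero_iff_of_nonneg fun i _ => sub_nonneg.2 (h1 i)).1 hyi i
          (Finset.mem_univ i)
        linarith
      · field_simp
        ring
    · by_cases hj : (j : ℕ) < k
      · simp only [hA, Matrix.of_apply, if_pos hj]
        rw [← Finset.sum_div, hy, div_self hk0.ne']
      · simp only [hA, Matrix.of_apply, if_neg hj]
        have hlt : (0 : ℝ) < d - k := sub_pos.2 (by exact_mod_cast (not_lt.1 hj).trans_lt j.2)
        rw [← Finset.sum_div, Finset.sum_sub_distrib, hy]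
        simp
        exact hlt.ne'
  obtain ⟨c, hc0, hc1, hc⟩ := exists_eq_sum_perm_of_mem_doublyStochastic hmem
  refine ⟨c, fun π => Finset.univ.filter fun i => (π i : ℕ) < k, hc0, hc1, fun π => ?_, fun i => ?_⟩
  · refine (Finset.card_map π.toEmbedding).symm.trans (Eq.trans (congrArg _ ?_) hcard)
    ext i
    simp
  · rw [← hpart i, ← hc]
    simp only [Matrix.sum_apply, Matrix.smul_apply, smul_eq_mul]
    rw [Finset.sum_comm]
    refine Finset.sum_congr rfl fun π _ => ?_
    rw [← Finset.mul_sum]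
    congr 1
    simp [Equiv.Perm.permMatrix, PEquiv.toMatrix_apply, Finset.sum_ite_eq]

/-- Writing y as a convex combination of indicators of k-sets writes y·c as the same combination of
restrictions of c, each of Euclidean norm at most M. -/
theorem kSupportNorm_le_of_hypersimplex {k : ℕ} (hk : 1 ≤ k) (hkd : k ≤ d) {y c : Fin d → ℝ}
    (h0 : ∀ i, 0 ≤ y i) (h1 : ∀ i, y i ≤ 1) (hy : ∑ i, y i = k) {M : ℝ} (hM : 0 ≤ M)
    (hc : ∀ h : Finset (Fin d), h.card = k → ∑ i ∈ h, c i ^ 2 ≤ M ^ 2) :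
    kSupportNorm k (WithLp.toLp 2 fun i => y i * c i) ≤ M := by
  classical
  obtain ⟨l, h, hl0, hl1, hhk, hyl⟩ := exists_convex_combination_indicator hk hkd h0 h1 hy
  set u : Equiv.Perm (Fin d) → EuclideanSpace ℝ (Fin d) := fun π =>
    WithLp.toLp 2 fun i => if i ∈ h π then c i else 0 with hu
  have hun : ∀ π, ‖u π‖ ≤ M := by
    intro π
    refine le_of_sq_le_sq ?_ hM
    rw [EuclideanSpace.real_norm_sq_eq]
    simpa [hu, ite_pow, Finset.sum_ite_mem] using hc (h π) (hhk π)
  refine (kSupportNorm_le_sum h (fun π => (hhk π).le) (fun π => l π • u π)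
    (fun π i hi => by simp [hu, hi]) ?_).trans ?_
  · ext i
    simp only [WithLp.ofLp_sum, Finset.sum_apply, WithLp.ofLp_smul, Pi.smul_apply, smul_eq_mul,
      hyl i, hu, Finset.sum_mul]
    refine Finset.sum_congr rfl fun π _ => ?_
    split_ifs <;> ring
  · calc ∑ π, ‖l π • u π‖ ≤ ∑ π, l π * M := Finset.sum_le_sum fun π _ => by
          rw [norm_smul, Real.norm_of_nonneg (hl0 π)]
          exact mul_le_mul_of_nonneg_left (hun π) (hl0 π)
      _ = M := by rw [← Finset.sum_mul, hl1, one_mul]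

/-- The bound behind the sum of the `q + p` largest terms of a sequence that is constant after its
first `q` terms. -/
theorem sum_mul_le_top {q p : ℕ} (hq : q ≤ d) {c m : Fin d → ℝ} {c₀ : ℝ} (hc₀ : 0 ≤ c₀)
    (hlow : ∀ j : Fin d, (j : ℕ) < q → c₀ ≤ c j) (hhigh : ∀ j : Fin d, q ≤ (j : ℕ) → c j = c₀)
    (hm1 : ∀ j, m j ≤ 1) (hm : ∑ j, m j ≤ q + p) :
    ∑ j, c j * m j ≤ ∑ j ∈ Finset.univ.filter (fun j : Fin d => (j : ℕ) < q), c j + p * c₀ := by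
  have hcard : (Finset.univ.filter fun j : Fin d => (j : ℕ) < q).card = q := by
    rw [Fin.card_filter_val_lt, min_eq_right hq]
  -- After subtracting the level c₀ only the first q terms survive, and there m_j ≤ 1 suffices.
  have h1 : ∑ j, c j * m j = ∑ j, (c j - c₀) * m j + c₀ * ∑ j, m j := by
    rw [Finset.mul_sum, ← Finset.sum_add_distrib]
    exact Finset.sum_congr rfl fun j _ => by ring
  have h2 : ∑ j, (c j - c₀) * m j ≤ ∑ j ∈ Finset.univ.filter (fun j : Fin d => (j : ℕ) < q), (c j - c₀) := by
    rw [Finset.sum_filter]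
    refine Finset.sum_le_sum fun j _ => ?_
    split_ifs with h
    · exact mul_le_of_le_one_right (sub_nonneg.2 (hlow j h)) (hm1 j)
    · rw [hhigh j (not_lt.1 h), sub_self, zero_mul]
  rw [Finset.sum_sub_distrib, Finset.sum_const, hcard, nsmul_eq_mul] at h2
  have h3 := mul_le_mul_of_nonneg_left hm hc₀
  linarith

end

/-! ### Singular bases, duality and coefficient arrays. -/

section

variable {d : ℕ}

theorem exists_orthonormalBasis_inner_singVal (X : Matrix (Fin d) (Fin d) ℝ) :
    ∃ b : OrthonormalBasis (Fin d) ℝ (EuclideanSpace ℝ (Fin d)), ∀ i j,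
      inner ℝ (Matrix.toEuclideanLin X (b i)) (Matrix.toEuclideanLin X (b j)) =
        if i = j then singVal X (j + 1) ^ 2 else 0 := by
  set T := Matrix.toEuclideanLin X
  have hn : Module.finrank ℝ (EuclideanSpace ℝ (Fin d)) = d := by simp
  refine ⟨T.isSymmetric_adjoint_comp_self.eigenvectorBasis hn, fun i j => ?_⟩
  rw [← LinearMap.adjoint_inner_right, ← LinearMap.comp_apply,
    LinearMap.IsSymmetric.apply_eigenvectorBasis, inner_smul_right,
    OrthonormalBasis.inner_eq_ite, ← T.sq_singularValues_fin hn]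
  split_ifs <;> simp [singVal, T]

theorem norm_toEuclideanLin_eq_singVal {X : Matrix (Fin d) (Fin d) ℝ}
    {b : OrthonormalBasis (Fin d) ℝ (EuclideanSpace ℝ (Fin d))}
    (hb : ∀ i j, inner ℝ (Matrix.toEuclideanLin X (b i)) (Matrix.toEuclideanLin X (b j)) =
        if i = j then singVal X (j + 1) ^ 2 else 0) (i : Fin d) :
    ‖Matrix.toEuclideanLin X (b i)‖ = singVal X (i + 1) := by
  have h := hb i i
  rw [if_pos rfl, real_inner_self_eq_norm_sq] at h
  exact (sq_eq_sq₀ (norm_nonneg _) ((Matrix.toEuclideanLin X).singularValues_nonneg _)).1 h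

/-- The singular value decomposition of a square matrix. -/
theorem exists_singular_bases (X : Matrix (Fin d) (Fin d) ℝ) :
    ∃ a b : OrthonormalBasis (Fin d) ℝ (EuclideanSpace ℝ (Fin d)), ∀ j,
      Matrix.toEuclideanLin X (b j) = singVal X (j + 1) • a j := by
  obtain ⟨b, hb⟩ := exists_orthonormalBasis_inner_singVal X
  set v : Fin d → EuclideanSpace ℝ (Fin d) := fun j =>
    (singVal X (j + 1))⁻¹ • Matrix.toEuclideanLin X (b j) with hv
  set s : Set (Fin d) := {j | singVal X (j + 1) ≠ 0}
  have hon : Orthonormal ℝ (s.domRestrict v) := by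
    rw [orthonormal_iff_ite]
    rintro ⟨i, hi⟩ ⟨j, hj⟩
    simp only [Set.domRestrict_apply, hv, real_inner_smul_left, real_inner_smul_right, hb,
      Subtype.mk.injEq]
    split_ifs with h
    · subst h
      have : singVal X (i + 1) ≠ 0 := hi
      field_simp
    · simp
  -- Left singular vectors are determined only where the singular value is nonzero; the remaining
  -- ones are an arbitrary orthonormal completion.
  obtain ⟨a, ha⟩ := hon.exists_orthonormalBasis_extension_of_card_eq (by simp)
  refine ⟨a, b, fun j => ?_⟩
  by_cases hj : singVal X (j + 1) = 0
  · have := norm_toEuclideanLin_eq_singVal hb j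
    rw [hj, norm_eq_zero] at this
    rw [this, hj, zero_smul]
  · rw [ha j hj, hv, smul_smul, mul_inv_cancel₀ hj, one_smul]

theorem matInner_eq_sum_inner (b : OrthonormalBasis (Fin d) ℝ (EuclideanSpace ℝ (Fin d)))
    (X Y : Matrix (Fin d) (Fin d) ℝ) :
    matInner X Y =
      ∑ j, inner ℝ (Matrix.toEuclideanLin X (b j)) (Matrix.toEuclideanLin Y (b j)) := by
  have hrow : ∀ (Z : Matrix (Fin d) (Fin d) ℝ) (i j : Fin d),
      Matrix.toEuclideanLin Z (b j) i = inner ℝ (WithLp.toLp 2 (Z i)) (b j) := by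
    intro Z i j
    simp [Matrix.toLpLin_apply, Matrix.mulVec, dotProduct, PiLp.inner_apply, mul_comm]
  have hin : ∀ i, ∑ j, X i j * Y i j =
      ∑ j, inner ℝ (WithLp.toLp 2 (X i)) (b j) * inner ℝ (WithLp.toLp 2 (Y i)) (b j) := by
    intro i
    have h := b.sum_inner_mul_inner (WithLp.toLp 2 (X i)) (WithLp.toLp 2 (Y i))
    simp only [real_inner_comm (WithLp.toLp 2 (Y i))] at h
    rw [h]
    simp [PiLp.inner_apply]
  rw [matInner, Finset.sum_congr rfl fun i _ => hin i, Finset.sum_comm]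
  refine Finset.sum_congr rfl fun j _ => ?_
  rw [PiLp.inner_apply]
  refine Finset.sum_congr rfl fun i _ => ?_
  simp [hrow, mul_comm]

/-- Duality between the spectral `k`-support norm and the `2`-`k` Ky Fan norm. -/
theorem matInner_le_mul_spectralKSupportNorm {k : ℕ} (hk : 1 ≤ k) {κ : ℝ} (hκ : 0 ≤ κ)
    {X W : Matrix (Fin d) (Fin d) ℝ}
    (hW : ∀ (b : OrthonormalBasis (Fin d) ℝ (EuclideanSpace ℝ (Fin d))) (g : Finset (Fin d)),
      g.card ≤ k → ∑ i ∈ g, ‖Matrix.toEuclideanLin W (b i)‖ ^ 2 ≤ κ ^ 2) :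
    matInner X W ≤ κ * spectralKSupportNorm k X := by
  obtain ⟨b, hb⟩ := exists_orthonormalBasis_inner_singVal X
  -- In a right singular basis of X, ⟨X, W⟩ ≤ ∑ σ_j ‖W b_j‖. Each decomposition of σ then allows
  -- Cauchy–Schwarz on every support set, where the Ky Fan hypothesis applies.
  have key : ∀ v : Finset (Fin d) → EuclideanSpace ℝ (Fin d),
      (∀ g ∈ subsetsCardLE k d, ∀ i, i ∉ g → v g i = 0) →
      ∑ g ∈ subsetsCardLE k d, v g = singVec X →
      matInner X W ≤ κ * ∑ g ∈ subsetsCardLE k d, ‖v g‖ := by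
    intro v hv hsum
    have h1 : matInner X W ≤ ∑ j, singVec X j * ‖Matrix.toEuclideanLin W (b j)‖ := by
      rw [matInner_eq_sum_inner b]
      refine Finset.sum_le_sum fun j _ => (real_inner_le_norm _ _).trans (le_of_eq ?_)
      rw [norm_toEuclideanLin_eq_singVal hb]
      rfl
    refine h1.trans ?_
    rw [← hsum]
    simp only [WithLp.ofLp_sum, Finset.sum_apply, Finset.sum_mul]
    rw [Finset.sum_comm, Finset.mul_sum]
    refine Finset.sum_le_sum fun g hg => ?_
    have hgk : g.card ≤ k := (Finset.mem_filter.1 hg).2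
    rw [← Finset.sum_subset (Finset.subset_univ g) fun i _ hi => by rw [hv g hg i hi, zero_mul]]
    have hvg : ∑ i ∈ g, v g i ^ 2 = ‖v g‖ ^ 2 := by
      rw [EuclideanSpace.real_norm_sq_eq]
      exact Finset.sum_subset (Finset.subset_univ g) fun i _ hi => by
        rw [hv g hg i hi]
        simp
    refine (Real.sum_mul_le_sqrt_mul_sqrt g _ _).trans ?_
    rw [hvg, Real.sqrt_sq (norm_nonneg _), mul_comm]
    exact mul_le_mul_of_nonneg_right ((Real.sqrt_le_left hκ).2 (hW b g hgk)) (norm_nonneg _)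
  obtain ⟨v₀, hv₀, hs₀⟩ := exists_kSupport_decomposition hk (singVec X)
  -- Passing to the infimum divides by κ, so κ = 0 is settled with one explicit decomposition.
  rcases hκ.eq_or_lt with h0 | h0
  · have := key v₀ hv₀ hs₀
    rwa [← h0, zero_mul] at this ⊢
  · rw [← div_le_iff₀' h0]
    refine le_csInf ⟨_, v₀, hv₀, hs₀, rfl⟩ ?_
    rintro _ ⟨v, hv, hs, rfl⟩
    rw [div_le_iff₀' h0]
    exact key v hv hs

/-- The matrix whose array of coefficients in the bases `a` and `b` is `t`. -/
noncomputable def ofCoeff (a b : OrthonormalBasis (Fin d) ℝ (EuclideanSpace ℝ (Fin d)))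
    (t : Fin d → Fin d → ℝ) : Matrix (Fin d) (Fin d) ℝ :=
  Matrix.of fun p q => ∑ i, ∑ j, t i j * (a i p * b j q)

theorem toEuclideanLin_ofCoeff (a b : OrthonormalBasis (Fin d) ℝ (EuclideanSpace ℝ (Fin d)))
    (t : Fin d → Fin d → ℝ) (x : EuclideanSpace ℝ (Fin d)) :
    Matrix.toEuclideanLin (ofCoeff a b t) x = ∑ i, (∑ j, t i j * inner ℝ (b j) x) • a i := by
  ext p
  simp only [Matrix.toLpLin_apply, Matrix.mulVec, dotProduct, ofCoeff, Matrix.of_apply,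
    WithLp.ofLp_sum, Finset.sum_apply, WithLp.ofLp_smul, Pi.smul_apply, smul_eq_mul,
    PiLp.inner_apply, RCLike.inner_apply, conj_trivial, Finset.sum_mul, Finset.mul_sum]
  rw [Finset.sum_comm]
  refine Finset.sum_congr rfl fun i _ => ?_
  rw [Finset.sum_comm]
  refine Finset.sum_congr rfl fun j _ => ?_
  refine Finset.sum_congr rfl fun q _ => ?_
  ring

theorem norm_sq_toEuclideanLin_ofCoeff
    (a b : OrthonormalBasis (Fin d) ℝ (EuclideanSpace ℝ (Fin d))) (t : Fin d → Fin d → ℝ)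
    (x : EuclideanSpace ℝ (Fin d)) :
    ‖Matrix.toEuclideanLin (ofCoeff a b t) x‖ ^ 2 =
      ∑ i, (∑ j, t i j * inner ℝ (b j) x) ^ 2 := by
  rw [toEuclideanLin_ofCoeff, ← a.sum_sq_inner_right]
  refine Finset.sum_congr rfl fun i _ => ?_
  rw [a.orthonormal.inner_right_fintype]

/-- The array of coefficients of a matrix in the bases `a` and `b`. -/
noncomputable def coeffArray (a b : OrthonormalBasis (Fin d) ℝ (EuclideanSpace ℝ (Fin d)))
    (X : Matrix (Fin d) (Fin d) ℝ) : EuclideanSpace ℝ (Fin d × Fin d) :=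
  WithLp.toLp 2 fun p => inner ℝ (a p.1) (Matrix.toEuclideanLin X (b p.2))

theorem inner_coeffArray (a b : OrthonormalBasis (Fin d) ℝ (EuclideanSpace ℝ (Fin d)))
    (X Y : Matrix (Fin d) (Fin d) ℝ) :
    inner ℝ (coeffArray a b X) (coeffArray a b Y) = matInner X Y := by
  rw [matInner_eq_sum_inner b, PiLp.inner_apply, Fintype.sum_prod_type_right]
  refine Finset.sum_congr rfl fun j _ => ?_
  rw [← a.sum_inner_mul_inner]
  refine Finset.sum_congr rfl fun i _ => ?_
  simp [coeffArray, real_inner_comm, mul_comm]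

theorem coeffArray_ofCoeff (a b : OrthonormalBasis (Fin d) ℝ (EuclideanSpace ℝ (Fin d)))
    (t : Fin d → Fin d → ℝ) (p : Fin d × Fin d) : coeffArray a b (ofCoeff a b t) p = t p.1 p.2 := by
  have hb : ∀ j, inner ℝ (b j) (b p.2) = if j = p.2 then (1 : ℝ) else 0 :=
    fun j => b.inner_eq_ite j p.2
  simp [coeffArray, toEuclideanLin_ofCoeff, a.orthonormal.inner_right_fintype, hb]

end

/-! ### Rotation invariance and the Gaussian width. -/

section

variable {d : ℕ}

/-- The characteristic function of the array factors over its rows, each of which is a standard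
Gaussian vector. -/
theorem measurePreserving_flatten (d : ℕ) :
    MeasurePreserving
      (fun G : Fin d → Fin d → ℝ =>
        (WithLp.toLp 2 fun p => G p.1 p.2 : EuclideanSpace ℝ (Fin d × Fin d)))
      (stdGaussianArray d d) (stdGaussian (EuclideanSpace ℝ (Fin d × Fin d))) := by
  have hc : Continuous (fun G : Fin d → Fin d → ℝ =>
        (WithLp.toLp 2 fun p => G p.1 p.2 : EuclideanSpace ℝ (Fin d × Fin d))) := by fun_prop
  refine ⟨hc.measurable, ?_⟩
  have := Measure.isProbabilityMeasure_map (μ := stdGaussianArray d d) hc.measurable.aemeasurable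
  refine Measure.ext_of_charFun (funext fun t => ?_)
  have hrow : ∀ v : EuclideanSpace ℝ (Fin d),
      ∫ g : Fin d → ℝ, Complex.exp (((inner ℝ (WithLp.toLp 2 g) v : ℝ) : ℂ) * Complex.I)
        ∂(Measure.pi fun _ => gaussianReal 0 1) = Complex.exp (-‖v‖ ^ 2 / 2) := by
    intro v
    rw [← charFun_stdGaussian, ← map_pi_eq_stdGaussian, charFun_apply, integral_map
      (by fun_prop) (Continuous.aestronglyMeasurable (by fun_prop))]
  set r : Fin d → EuclideanSpace ℝ (Fin d) := fun i => WithLp.toLp 2 fun j => t (i, j) with hr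
  rw [charFun_apply, charFun_stdGaussian, integral_map hc.measurable.aemeasurable
    (Continuous.aestronglyMeasurable (by fun_prop))]
  have hsplit : ∀ G : Fin d → Fin d → ℝ,
      Complex.exp (((inner ℝ (WithLp.toLp 2 fun p : Fin d × Fin d => G p.1 p.2) t : ℝ) : ℂ) *
        Complex.I) =
      ∏ i, Complex.exp (((inner ℝ (WithLp.toLp 2 (G i)) (r i) : ℝ) : ℂ) * Complex.I) := by
    intro G
    rw [← Complex.exp_sum, ← Finset.sum_mul, ← Complex.ofReal_sum]
    simp [PiLp.inner_apply, Fintype.sum_prod_type, hr]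
  simp only [hsplit]
  rw [stdGaussianArray, integral_fintype_prod_eq_prod (f := fun i g =>
    Complex.exp (((inner ℝ (WithLp.toLp 2 g) (r i) : ℝ) : ℂ) * Complex.I))]
  simp only [hrow]
  rw [← Complex.exp_sum, ← Finset.sum_div, Finset.sum_neg_distrib]
  have hn : ‖t‖ ^ 2 = ∑ i, ‖r i‖ ^ 2 := by
    simp only [EuclideanSpace.real_norm_sq_eq, Fintype.sum_prod_type, hr]
  rw [← Complex.ofReal_pow, hn]
  push_cast
  rfl

/-- A change of orthonormal bases on both sides is a Frobenius isometry, with adjoint `ofCoeff`. -/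
theorem measurePreserving_coeffArray
    (a b : OrthonormalBasis (Fin d) ℝ (EuclideanSpace ℝ (Fin d))) :
    MeasurePreserving (fun G : Fin d → Fin d → ℝ => coeffArray a b (Matrix.of G))
      (stdGaussianArray d d) (stdGaussian (EuclideanSpace ℝ (Fin d × Fin d))) := by
  have h2 : MeasurePreserving (fun z : EuclideanSpace ℝ (Fin d × Fin d) =>
      coeffArray a b (Matrix.of fun i j => z (i, j)))
      (stdGaussian (EuclideanSpace ℝ (Fin d × Fin d)))
      (stdGaussian (EuclideanSpace ℝ (Fin d × Fin d))) := by
    have hco : ∀ t : EuclideanSpace ℝ (Fin d × Fin d),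
        coeffArray a b (ofCoeff a b fun i j => t (i, j)) = t := fun t => by
      ext p
      rw [coeffArray_ofCoeff]
    obtain ⟨vec, hvec⟩ : ∃ vec : Matrix (Fin d) (Fin d) ℝ → EuclideanSpace ℝ (Fin d × Fin d),
        ∀ x, vec x = WithLp.toLp 2 fun p => x p.1 p.2 := ⟨_, fun _ => rfl⟩
    have hin : ∀ x y, inner ℝ (vec x) (vec y) = matInner x y := by
      intro x y
      simp [PiLp.inner_apply, matInner, Fintype.sum_prod_type, hvec, mul_comm]
    have hunvec : ∀ x : EuclideanSpace ℝ (Fin d × Fin d),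
        vec (Matrix.of fun i j => x (i, j)) = x := fun x => by
      rw [hvec]
      rfl
    refine measurePreserving_stdGaussian ?_ (g := fun t => vec (ofCoeff a b fun i j => t (i, j)))
      (fun x t => ?_) fun t => ?_
    · simp only [coeffArray, Matrix.toLpLin_apply, Matrix.mulVec, dotProduct, PiLp.inner_apply,
        Matrix.of_apply]
      fun_prop
    · conv_lhs => rw [← hco t]
      conv_rhs => rw [← hunvec x]
      rw [inner_coeffArray, hin]
    · have h : ‖vec (ofCoeff a b fun i j => t (i, j))‖ ^ 2 = ‖t‖ ^ 2 := by
        rw [← real_inner_self_eq_norm_sq, hin, ← inner_coeffArray a b, hco,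
          real_inner_self_eq_norm_sq]
      exact (sq_eq_sq₀ (norm_nonneg _) (norm_nonneg _)).1 h
  have h := h2.comp (measurePreserving_flatten d)
  simp only [Function.comp_def] at h
  exact h

theorem integral_matInner_stdGaussianArray (X : Matrix (Fin d) (Fin d) ℝ) :
    Integrable (fun G : Fin d → Fin d → ℝ => matInner X (Matrix.of G)) (stdGaussianArray d d) ∧
      ∫ G, matInner X (Matrix.of G) ∂(stdGaussianArray d d) = 0 := by
  set c : EuclideanSpace ℝ (Fin d × Fin d) := WithLp.toLp 2 fun p => X p.1 p.2 with hc
  have hmp := measurePreserving_flatten d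
  have heq : ∀ G : Fin d → Fin d → ℝ, matInner X (Matrix.of G) = innerSL ℝ c
      (WithLp.toLp 2 fun p => G p.1 p.2 : EuclideanSpace ℝ (Fin d × Fin d)) := by
    intro G
    simp [PiLp.inner_apply, matInner, Fintype.sum_prod_type, hc, mul_comm]
  simp only [heq]
  constructor
  · refine hmp.integrable_comp_of_integrable (g := fun z => innerSL ℝ c z) ?_
    exact (innerSL ℝ c).integrable_comp (IsGaussian.integrable_id)
  · rw [← integral_strongDual_stdGaussian (innerSL ℝ c), ← hmp.map_eq,
      integral_map hmp.measurable.aemeasurable (Continuous.aestronglyMeasurable (by fun_prop))]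

theorem abs_le_one_of_mem_frobSphere {X : Matrix (Fin d) (Fin d) ℝ} (hX : X ∈ frobSphere d d)
    (i j : Fin d) : |X i j| ≤ 1 := by
  have h1 : matInner X X = 1 := by
    have h : √(matInner X X) = 1 := hX
    rwa [Real.sqrt_eq_one] at h
  have h2 : X i j * X i j ≤ matInner X X := by
    refine (Finset.single_le_sum (f := fun j => X i j * X i j)
      (fun j _ => mul_self_nonneg _) (Finset.mem_univ j)).trans ?_
    exact Finset.single_le_sum (f := fun i => ∑ j, X i j * X i j)
      (fun i _ => Finset.sum_nonneg fun j _ => mul_self_nonneg _) (Finset.mem_univ i)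
  rw [h1] at h2
  exact abs_le_one_iff_mul_self_le_one.2 h2

/-- Jensen's inequality, in the form Var f ≥ 0. Squaring w ≤ E f needs w ≥ 0, which holds because a
single X in `S` already contributes mean zero. -/
theorem gaussianWidth_sq_le {S : Set (Matrix (Fin d) (Fin d) ℝ)} (hS : S ⊆ frobSphere d d)
    {f : (Fin d → Fin d → ℝ) → ℝ} (hf : MemLp f 2 (stdGaussianArray d d)) (hf0 : ∀ G, 0 ≤ f G)
    (hle : ∀ G, ∀ X ∈ S, matInner X (Matrix.of G) ≤ f G) :
    gaussianWidth S ^ 2 ≤ ∫ G, f G ^ 2 ∂(stdGaussianArray d d) := by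
  have hb : ∀ X ∈ S, ∀ i j, |X i j| ≤ 1 := fun X hX => abs_le_one_of_mem_frobSphere (hS hX)
  have hi := integrable_supInner hb
  have h1 : gaussianWidth S ≤ ∫ G, f G ∂(stdGaussianArray d d) := by
    refine integral_mono hi (hf.integrable (by simp)) fun G => ?_
    refine Real.sSup_le ?_ (hf0 G)
    rintro _ ⟨X, hX, rfl⟩
    exact hle G X hX
  have h0 : 0 ≤ gaussianWidth S := by
    rcases S.eq_empty_or_nonempty with rfl | ⟨X, hX⟩
    · simp [gaussianWidth, supInner]
    · obtain ⟨hXi, hX0⟩ := integral_matInner_stdGaussianArray X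
      rw [← hX0]
      exact integral_mono hXi hi fun G =>
        le_csSup (bddAbove_matInner hb (Matrix.of G)) (Set.mem_image_of_mem _ hX)
  have h2 := variance_nonneg f (stdGaussianArray d d)
  rw [variance_eq_sub hf] at h2
  simp only [Pi.pow_apply] at h2
  have h3 := pow_le_pow_left₀ h0 h1 2
  linarith

end

/-! ### The random dual array and its mean squared distance to the Gaussian array. -/

noncomputable section

/-- The trailing block of a `d × d` array, with both indices at least `s`. -/
def trailingBlock {d : ℕ} (s : ℕ) (z : EuclideanSpace ℝ (Fin d × Fin d)) :
    EuclideanSpace ℝ ({i : Fin d // s ≤ (i : ℕ)} × {i : Fin d // s ≤ (i : ℕ)}) :=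
  WithLp.toLp 2 fun p => z (p.1, p.2)

/-- The array that agrees with `z` on the trailing block, and on the rest of the diagonal with the
multiple of `D` by the operator norm of that block. -/
def dualArray {d : ℕ} (s : ℕ) (D : Fin d → ℝ) (z : EuclideanSpace ℝ (Fin d × Fin d))
    (i j : Fin d) : ℝ :=
  if s ≤ (i : ℕ) ∧ s ≤ (j : ℕ) then z (i, j)
  else if i = j then ‖arrayOp (trailingBlock s z)‖ * D j else 0

end

section

variable {d : ℕ}

theorem continuous_trailingBlock (s : ℕ) :
    Continuous (trailingBlock s : EuclideanSpace ℝ (Fin d × Fin d) → _) := by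
  unfold trailingBlock
  fun_prop

theorem continuous_dualArray (s : ℕ) (D : Fin d → ℝ) (i j : Fin d) :
    Continuous fun z => dualArray s D z i j := by
  have := continuous_trailingBlock (d := d) s
  unfold dualArray
  split_ifs <;> fun_prop

theorem measurePreserving_trailingBlock (s : ℕ) :
    MeasurePreserving (trailingBlock s) (stdGaussian (EuclideanSpace ℝ (Fin d × Fin d)))
      (stdGaussian (EuclideanSpace ℝ
        ({i : Fin d // s ≤ (i : ℕ)} × {i : Fin d // s ≤ (i : ℕ)}))) :=
  measurePreserving_comp_stdGaussian
    (f := fun p : {i : Fin d // s ≤ (i : ℕ)} × {i : Fin d // s ≤ (i : ℕ)} =>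
      ((p.1 : Fin d), (p.2 : Fin d)))
    (Subtype.val_injective.prodMap Subtype.val_injective)

theorem card_subtype_le_val {s : ℕ} (hsd : s ≤ d) :
    (Fintype.card {i : Fin d // s ≤ (i : ℕ)} : ℝ) = d - s := by
  have h := Fintype.card_subtype_compl fun i : Fin d => (i : ℕ) < s
  simp only [not_lt] at h
  rw [h, Fintype.card_fin, Fintype.card_subtype, Fin.card_filter_val_lt, min_eq_right hsd,
    Nat.cast_sub hsd]

/-- The count is d² - (d-s)². -/
theorem sum_prod_not_block {s : ℕ} (hsd : s ≤ d) :
    ∑ p : Fin d × Fin d, (if s ≤ (p.1 : ℕ) ∧ s ≤ (p.2 : ℕ) then (0 : ℝ) else 1) =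
      s * (2 * d - s) := by
  have h1 : ∀ p : Fin d × Fin d, (if s ≤ (p.1 : ℕ) ∧ s ≤ (p.2 : ℕ) then (0 : ℝ) else 1) =
      1 - (if s ≤ (p.1 : ℕ) then 1 else 0) * (if s ≤ (p.2 : ℕ) then 1 else 0) := by
    intro p
    by_cases h : s ≤ (p.1 : ℕ) <;> by_cases h' : s ≤ (p.2 : ℕ) <;> simp [h, h']
  have h2 : ∑ i : Fin d, (if s ≤ (i : ℕ) then (1 : ℝ) else 0) = d - s := by
    rw [← card_subtype_le_val hsd, Fintype.card_subtype]
    simp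
  have h3 : ∑ i : Fin d, ∑ j : Fin d, (if s ≤ (i : ℕ) then (1 : ℝ) else 0) *
      (if s ≤ (j : ℕ) then 1 else 0) = (d - s) * (d - s) := by
    rw [← Finset.sum_mul_sum, h2]
  simp only [h1]
  rw [Finset.sum_sub_distrib, Fintype.sum_prod_type
    (f := fun p : Fin d × Fin d => (if s ≤ (p.1 : ℕ) then (1 : ℝ) else 0) *
      (if s ≤ (p.2 : ℕ) then 1 else 0)), h3]
  simp
  ring

theorem dualArray_deviation_sq (s : ℕ) (D : Fin d → ℝ) (z : EuclideanSpace ℝ (Fin d × Fin d)) :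
    ∑ p : Fin d × Fin d, (z p - dualArray s D z p.1 p.2) ^ 2 =
      ∑ p : Fin d × Fin d, (if s ≤ (p.1 : ℕ) ∧ s ≤ (p.2 : ℕ) then (0 : ℝ) else 1) * z p ^ 2 -
      ∑ j : Fin d, (if s ≤ (j : ℕ) then (0 : ℝ) else 2 * D j) *
        (‖arrayOp (trailingBlock s z)‖ * z (j, j)) +
      (∑ j : Fin d, if s ≤ (j : ℕ) then (0 : ℝ) else D j ^ 2) *
        ‖arrayOp (trailingBlock s z)‖ ^ 2 := by
  have hdiag : ∀ f : Fin d → ℝ, ∑ j, f j =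
      ∑ p : Fin d × Fin d, if p.1 = p.2 then f p.2 else 0 := by
    intro f
    rw [Fintype.sum_prod_type]
    simp
  rw [Finset.sum_mul, hdiag fun j => _ * (‖arrayOp (trailingBlock s z)‖ * z (j, j)),
    hdiag fun j => (if s ≤ (j : ℕ) then (0 : ℝ) else D j ^ 2) * _, ← Finset.sum_sub_distrib,
    ← Finset.sum_add_distrib]
  refine Finset.sum_congr rfl ?_
  rintro ⟨i, j⟩ -
  unfold dualArray
  by_cases hij : i = j
  · subst hij
    by_cases h : s ≤ (i : ℕ) <;> simp [h]
    ring
  · by_cases h : s ≤ (i : ℕ) ∧ s ≤ (j : ℕ) <;> simp [h, hij]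

/-- The entry (j, j) lies outside the trailing block, so changing its sign leaves the block norm
fixed and negates the integrand. -/
theorem integral_norm_trailingBlock_mul_diag {s : ℕ} {j : Fin d} (hj : ¬ s ≤ (j : ℕ)) :
    ∫ z, ‖arrayOp (trailingBlock s z)‖ * z (j, j)
      ∂(stdGaussian (EuclideanSpace ℝ (Fin d × Fin d))) = 0 := by
  obtain ⟨ε, hε⟩ : ∃ ε : Fin d × Fin d → ℝ, ∀ p, ε p = if p = (j, j) then -1 else 1 :=
    ⟨_, fun _ => rfl⟩
  have habs : ∀ p, |ε p| = 1 := by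
    intro p
    rw [hε]
    split_ifs <;> simp
  have hc := continuous_trailingBlock (d := d) s
  refine integral_eq_zero_of_sign habs (by fun_prop) fun z => ?_
  have : trailingBlock s (WithLp.toLp 2 fun p : Fin d × Fin d => ε p * z p) =
      trailingBlock s z := by
    ext p
    have hp : ((p.1 : Fin d), (p.2 : Fin d)) ≠ (j, j) := by
      intro h
      exact hj ((Prod.mk.inj h).1 ▸ p.1.2)
    simp only [trailingBlock]
    rw [hε, if_neg hp, one_mul]
  rw [this]
  simp only
  rw [hε, if_pos rfl]
  ring

theorem integral_dualArray_deviation_sq_le {s : ℕ} (hsd : s ≤ d) (D : Fin d → ℝ) :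
    Integrable (fun z => ∑ p : Fin d × Fin d, (z p - dualArray s D z p.1 p.2) ^ 2)
        (stdGaussian (EuclideanSpace ℝ (Fin d × Fin d))) ∧
      ∫ z, ∑ p : Fin d × Fin d, (z p - dualArray s D z p.1 p.2) ^ 2
        ∂(stdGaussian (EuclideanSpace ℝ (Fin d × Fin d))) ≤
      s * (2 * d - s) +
        4 * (d - s) * ∑ j : Fin d, if s ≤ (j : ℕ) then (0 : ℝ) else D j ^ 2 := by
  set γ := stdGaussian (EuclideanSpace ℝ (Fin d × Fin d))
  set t : EuclideanSpace ℝ (Fin d × Fin d) → ℝ := fun z => ‖arrayOp (trailingBlock s z)‖ with ht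
  have htc : Continuous t := by
    have := continuous_trailingBlock (d := d) s
    fun_prop
  have hmp := measurePreserving_trailingBlock (d := d) s
  have hti : Integrable (fun z => t z ^ 2) γ :=
    hmp.integrable_comp_of_integrable integrable_arrayOp_sq
  have htle : ∫ z, t z ^ 2 ∂γ ≤ 4 * (d - s) := by
    have h := integral_arrayOp_sq_le (J := {i : Fin d // s ≤ (i : ℕ)})
    rw [card_subtype_le_val hsd, ← hmp.map_eq, integral_map hmp.measurable.aemeasurable
      (Continuous.aestronglyMeasurable (by fun_prop))] at h
    exact h
  have hzi : ∀ p, Integrable (fun z : EuclideanSpace ℝ (Fin d × Fin d) => z p ^ 2) γ :=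
    fun p => integrable_eval_sq_stdGaussian p
  have htzi : ∀ j : Fin d, Integrable (fun z => t z * z (j, j)) γ := by
    intro j
    have hzc : Continuous fun z : EuclideanSpace ℝ (Fin d × Fin d) => z (j, j) := by fun_prop
    refine (hti.add (hzi (j, j))).mono' (htc.mul hzc).aestronglyMeasurable (Filter.Eventually.of_forall fun z => ?_)
    rw [Real.norm_eq_abs, abs_le, Pi.add_apply]
    constructor <;> nlinarith [sq_nonneg (t z + z (j, j)), sq_nonneg (t z - z (j, j))]
  have htz : ∀ j : Fin d, ¬ s ≤ (j : ℕ) → ∫ z, t z * z (j, j) ∂γ = 0 := fun j hj =>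
    integral_norm_trailingBlock_mul_diag hj
  set A := ∑ j : Fin d, if s ≤ (j : ℕ) then (0 : ℝ) else D j ^ 2 with hA
  have hA0 : 0 ≤ A := Finset.sum_nonneg fun j _ => by split_ifs <;> positivity
  have i1 : Integrable (fun z : EuclideanSpace ℝ (Fin d × Fin d) => ∑ p : Fin d × Fin d,
      (if s ≤ (p.1 : ℕ) ∧ s ≤ (p.2 : ℕ) then (0 : ℝ) else 1) * z p ^ 2) γ :=
    integrable_finsetSum _ fun p _ => (hzi p).const_mul _
  have i2 : Integrable (fun z => ∑ j : Fin d, (if s ≤ (j : ℕ) then (0 : ℝ) else 2 * D j) *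
      (t z * z (j, j))) γ := integrable_finsetSum _ fun j _ => (htzi j).const_mul _
  have e1 : ∫ z, (∑ p : Fin d × Fin d,
      (if s ≤ (p.1 : ℕ) ∧ s ≤ (p.2 : ℕ) then (0 : ℝ) else 1) * z p ^ 2) ∂γ =
      s * (2 * d - s) := by
    refine (integral_finsetSum _ fun p _ => (hzi p).const_mul _).trans ?_
    rw [← sum_prod_not_block hsd]
    refine Finset.sum_congr rfl fun p _ => ?_
    rw [integral_const_mul, integral_eval_sq_stdGaussian, mul_one]
  have e2 : ∫ z, (∑ j : Fin d, (if s ≤ (j : ℕ) then (0 : ℝ) else 2 * D j) *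
      (t z * z (j, j))) ∂γ = 0 := by
    refine (integral_finsetSum _ fun j _ => (htzi j).const_mul _).trans ?_
    refine Finset.sum_eq_zero fun j _ => ?_
    rw [integral_const_mul]
    split_ifs with h
    · rw [zero_mul]
    · rw [htz j h, mul_zero]
  simp only [dualArray_deviation_sq]
  refine ⟨(i1.sub i2).add (hti.const_mul A), ?_⟩
  have e3 := integral_add (i1.sub i2) (hti.const_mul A)
  simp only [Pi.sub_apply] at e3
  rw [e3, integral_sub i1 i2, e1, e2, integral_const_mul]
  nlinarith [mul_le_mul_of_nonneg_left htle hA0]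

end

/-! ### Ky Fan estimates for the dual array, and index bookkeeping. -/

section

variable {d : ℕ}

/-- The array is block diagonal: diagonal on the first s directions, and on the rest a block that
stretches by at most its own operator norm. -/
theorem norm_sq_toEuclideanLin_dualArray_le
    (a b : OrthonormalBasis (Fin d) ℝ (EuclideanSpace ℝ (Fin d))) (s : ℕ) (D : Fin d → ℝ)
    (z : EuclideanSpace ℝ (Fin d × Fin d)) (x : EuclideanSpace ℝ (Fin d)) :
    ‖Matrix.toEuclideanLin (ofCoeff a b (dualArray s D z)) x‖ ^ 2 ≤
      ∑ j : Fin d, (if s ≤ (j : ℕ) then ‖arrayOp (trailingBlock s z)‖ ^ 2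
        else (‖arrayOp (trailingBlock s z)‖ * D j) ^ 2) * inner ℝ (b j) x ^ 2 := by
  set t := ‖arrayOp (trailingBlock s z)‖ with ht
  set β : EuclideanSpace ℝ {i : Fin d // s ≤ (i : ℕ)} :=
    WithLp.toLp 2 fun i => inner ℝ (b i) x with hβ
  rw [norm_sq_toEuclideanLin_ofCoeff,
    ← Fintype.sum_subtype_add_sum_subtype (fun i : Fin d => s ≤ (i : ℕ)),
    ← Fintype.sum_subtype_add_sum_subtype (fun i : Fin d => s ≤ (i : ℕ)) fun j =>
      (if s ≤ (j : ℕ) then t ^ 2 else (t * D j) ^ 2) * inner ℝ (b j) x ^ 2]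
  refine add_le_add ?_ (le_of_eq ?_)
  · have h1 : ∀ i : {i : Fin d // s ≤ (i : ℕ)},
        ∑ j, dualArray s D z i j * inner ℝ (b j) x = arrayOp (trailingBlock s z) β i := by
      intro i
      rw [arrayOp_apply, ← Fintype.sum_subtype_add_sum_subtype (fun j : Fin d => s ≤ (j : ℕ))]
      rw [Finset.sum_eq_zero (s := (Finset.univ : Finset {j : Fin d // ¬ s ≤ (j : ℕ)})), add_zero]
      · refine Finset.sum_congr rfl fun j _ => ?_
        simp [dualArray, i.2, j.2, trailingBlock, hβ]
      · intro j _
        have hij : (i : Fin d) ≠ j := fun h => j.2 (h ▸ i.2)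
        simp [dualArray, hij, j.2]
    have h2 : ∀ i : {i : Fin d // s ≤ (i : ℕ)},
        (if s ≤ ((i : Fin d) : ℕ) then t ^ 2 else (t * D i) ^ 2) * inner ℝ (b i) x ^ 2 =
          t ^ 2 * β i ^ 2 := by
      intro i
      rw [if_pos i.2]
    simp only [h1, h2]
    rw [← Finset.mul_sum, ← EuclideanSpace.real_norm_sq_eq, ← EuclideanSpace.real_norm_sq_eq,
      ← mul_pow]
    exact pow_le_pow_left₀ (norm_nonneg _) (ContinuousLinearMap.le_opNorm _ _) 2
  · refine Finset.sum_congr rfl fun i _ => ?_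
    rw [if_neg i.2, ← mul_pow, Finset.sum_eq_single (i : Fin d)]
    · simp [dualArray, i.2, ht]
    · intro j _ hj
      simp [dualArray, i.2, hj.symm]
    · simp

/-- The sum of the squared norms of the images of at most `q + p` orthonormal vectors. -/
theorem sum_norm_sq_le_top {q p : ℕ} (hq : q ≤ d)
    {T : EuclideanSpace ℝ (Fin d) → EuclideanSpace ℝ (Fin d)}
    {b : OrthonormalBasis (Fin d) ℝ (EuclideanSpace ℝ (Fin d))} {c : Fin d → ℝ} {c₀ : ℝ}
    (hT : ∀ x, ‖T x‖ ^ 2 ≤ ∑ j, c j * inner ℝ (b j) x ^ 2) (hc₀ : 0 ≤ c₀)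
    (hlow : ∀ j : Fin d, (j : ℕ) < q → c₀ ≤ c j) (hhigh : ∀ j : Fin d, q ≤ (j : ℕ) → c j = c₀)
    (b' : OrthonormalBasis (Fin d) ℝ (EuclideanSpace ℝ (Fin d))) {g : Finset (Fin d)}
    (hg : g.card ≤ q + p) :
    ∑ i ∈ g, ‖T (b' i)‖ ^ 2 ≤
      ∑ j ∈ Finset.univ.filter (fun j : Fin d => (j : ℕ) < q), c j + p * c₀ := by
  refine (Finset.sum_le_sum fun i _ => hT (b' i)).trans ?_
  rw [Finset.sum_comm]
  simp only [← Finset.mul_sum]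
  -- The weights ∑_{i∈g} ⟨b_j, b'_i⟩² are at most 1 by Bessel's inequality, and they sum to |g| by
  -- Parseval's identity.
  refine sum_mul_le_top hq hc₀ hlow hhigh (fun j => ?_) ?_
  · have h := b'.sum_sq_inner_left (b j)
    rw [b.norm_eq_one, one_pow] at h
    rw [← h]
    exact Finset.sum_le_sum_of_subset_of_nonneg (Finset.subset_univ g) fun _ _ _ => sq_nonneg _
  · rw [Finset.sum_comm]
    simp only [b.sum_sq_inner_right, b'.norm_eq_one, one_pow]
    simp only [Finset.sum_const, nsmul_eq_mul, mul_one]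
    exact_mod_cast hg

theorem sum_filter_val_succ {lo hi : ℕ} (hhi : hi ≤ d) (f : ℕ → ℝ) :
    ∑ j ∈ Finset.univ.filter (fun j : Fin d => lo ≤ (j : ℕ) ∧ (j : ℕ) < hi), f (j + 1) =
      ∑ i ∈ Finset.Icc (lo + 1) hi, f i := by
  refine Finset.sum_bij (fun j _ => (j : ℕ) + 1) (fun j hj => ?_) (fun i _ j _ h => ?_)
    (fun i hi' => ?_) fun _ _ => rfl
  · simp only [Finset.mem_filter, Finset.mem_univ, true_and] at hj
    rw [Finset.mem_Icc]
    lia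
  · exact Fin.ext (by lia)
  · rw [Finset.mem_Icc] at hi'
    exact ⟨⟨i - 1, by lia⟩, by simp; lia, by simp; lia⟩

theorem singVal_antitone (X : Matrix (Fin d) (Fin d) ℝ) : Antitone (singVal X) := fun _ _ hab =>
  (Matrix.toEuclideanLin X).singularValues_antitone (Nat.sub_le_sub_right hab 1)

theorem singVal_nonneg (X : Matrix (Fin d) (Fin d) ℝ) (i : ℕ) : 0 ≤ singVal X i :=
  (Matrix.toEuclideanLin X).singularValues_nonneg _

theorem finrank_range_toEuclideanLin (X : Matrix (Fin d) (Fin d) ℝ) :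
    Module.finrank ℝ (Matrix.toEuclideanLin X).range = X.rank := by
  rw [X.rank_eq_finrank_range_toLin (PiLp.basisFun 2 ℝ (Fin d)) (PiLp.basisFun 2 ℝ (Fin d))]
  rw [← Matrix.toLpLin_eq_toLin]

theorem singVal_pos {X : Matrix (Fin d) (Fin d) ℝ} {i : ℕ} (h1 : 1 ≤ i) (hi : i ≤ X.rank) :
    0 < singVal X i :=
  (LinearMap.singularValues_pos_iff_lt_finrank_range _).2 (by
    rw [finrank_range_toEuclideanLin]
    lia)

theorem singVal_eq_zero {X : Matrix (Fin d) (Fin d) ℝ} {i : ℕ} (hi : X.rank < i) :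
    singVal X i = 0 :=
  (LinearMap.singularValues_eq_zero_iff_le_finrank_range _).2 (by
    rw [finrank_range_toEuclideanLin]
    lia)

end

/-! ### The closed-form norm bound and the subgradient inequality. -/

section

variable {d : ℕ}

/-- With q = k - r - 1 = |I₂|, the defining inequalities of r say that S/(r+1) separates the first q
singular values from the others. Positivity of S uses k ≤ rank. -/
theorem isKSupportIndex_bounds {q r : ℕ} {X : Matrix (Fin d) (Fin d) ℝ}
    (hr : IsKSupportIndex (q + r + 1) X r) (hqd : q + r + 1 ≤ X.rank) :
    0 < ∑ i ∈ Finset.Icc (q + 1) X.rank, singVal X i ∧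
    (∀ j < q, (∑ i ∈ Finset.Icc (q + 1) X.rank, singVal X i) / (r + 1) ≤ singVal X (j + 1)) ∧
    ∀ j, q ≤ j → singVal X (j + 1) ≤
      (∑ i ∈ Finset.Icc (q + 1) X.rank, singVal X i) / (r + 1) := by
  obtain ⟨-, h1, h2⟩ := hr
  have hrank : X.rank ≤ d := by simpa using X.rank_le_card_width
  rw [show q + r + 1 - r = q + 1 by lia] at h1 h2
  rw [show q + 1 - 1 = q by lia] at h1
  have hsum : ∑ i ∈ Finset.Icc (q + 1) d, singVal X i =
      ∑ i ∈ Finset.Icc (q + 1) X.rank, singVal X i := by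
    refine (Finset.sum_subset (Finset.Icc_subset_Icc_right hrank) fun i hi hi' => ?_).symm
    refine singVal_eq_zero ?_
    rw [Finset.mem_Icc] at hi hi'
    lia
  rw [hsum, one_div_mul_eq_div] at h1 h2
  refine ⟨?_, fun j hj => ?_, fun j hj => ?_⟩
  · refine Finset.sum_pos (fun i hi => ?_) ⟨q + 1, by rw [Finset.mem_Icc]; lia⟩
    rw [Finset.mem_Icc] at hi
    exact singVal_pos (by lia) hi.2
  · exact (h1 (by lia)).le.trans (singVal_antitone X (by lia))
  · exact (singVal_antitone X (by lia)).trans h2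

theorem sum_filter_lt_eq_Icc {q : ℕ} (hq : q ≤ d) (f : ℕ → ℝ) :
    ∑ j ∈ Finset.univ.filter (fun j : Fin d => (j : ℕ) < q), f (j + 1) =
      ∑ i ∈ Finset.Icc 1 q, f i := by
  have h := sum_filter_val_succ (lo := 0) hq f
  simpa using h

/-- An upper bound for the spectral `k`-support norm by its closed form. -/
theorem spectralKSupportNorm_le {q r : ℕ} {X : Matrix (Fin d) (Fin d) ℝ}
    (hr : IsKSupportIndex (q + r + 1) X r) (hqd : q + r + 1 ≤ X.rank) :
    spectralKSupportNorm (q + r + 1) X ≤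
      √(∑ i ∈ Finset.Icc 1 q, singVal X i ^ 2 +
        (∑ i ∈ Finset.Icc (q + 1) X.rank, singVal X i) ^ 2 / (r + 1)) := by
  obtain ⟨hS, hlow, hhigh⟩ := isKSupportIndex_bounds hr hqd
  have hrank : X.rank ≤ d := by simpa using X.rank_le_card_width
  set S := ∑ i ∈ Finset.Icc (q + 1) X.rank, singVal X i with hSdef
  have hr0 : (0 : ℝ) < r + 1 := by positivity
  -- The factorisation σ = y·c flattens the tail of c to the level S/(r+1). The index condition
  -- gives y ≤ 1 and makes c largest on the first q places, so the k largest values of c² sum to M².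
  have hw : singVec X = WithLp.toLp 2 fun i : Fin d =>
      (if (i : ℕ) < q then 1 else (r + 1) * singVal X (i + 1) / S) *
        (if (i : ℕ) < q then singVal X (i + 1) else S / (r + 1)) := by
    ext i
    simp only [singVec]
    split_ifs
    · rw [one_mul]
    · field_simp
  rw [spectralKSupportNorm, hw]
  refine kSupportNorm_le_of_hypersimplex (by lia) (by lia) (fun i => ?_) (fun i => ?_) ?_
    (Real.sqrt_nonneg _) fun h hh => ?_
  · split_ifs
    · exact zero_le_one
    · exact div_nonneg (mul_nonneg hr0.le (singVal_nonneg X _)) hS.le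
  · split_ifs with hi
    · exact le_rfl
    · rw [div_le_one hS, ← le_div_iff₀' hr0]
      exact hhigh i (not_lt.1 hi)
  · have h1 : ∑ i ∈ Finset.univ.filter (fun i : Fin d => ¬ (i : ℕ) < q), singVal X (i + 1) = S := by
      rw [hSdef, ← sum_filter_val_succ hrank]
      refine (Finset.sum_subset (fun i hi => ?_) fun i hi hi' => singVal_eq_zero ?_).symm
      · simp only [Finset.mem_filter, Finset.mem_univ, true_and] at hi ⊢
        lia
      · simp only [Finset.mem_filter, Finset.mem_univ, true_and] at hi hi'
        lia
    rw [Finset.sum_ite, ← Finset.sum_div, ← Finset.mul_sum, h1, mul_div_cancel_right₀ _ hS.ne']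
    rw [Finset.sum_const, Fin.card_filter_val_lt, min_eq_right (by lia)]
    push_cast
    rw [nsmul_eq_mul]
    ring
  · rw [Real.sq_sqrt (by positivity)]
    have hin : ∑ i ∈ h, (if (i : ℕ) < q then singVal X (i + 1) else S / (r + 1)) ^ 2 =
        ∑ i : Fin d, (if (i : ℕ) < q then singVal X (i + 1) else S / (r + 1)) ^ 2 *
          (if i ∈ h then 1 else 0) := by
      simp
    rw [hin]
    refine (sum_mul_le_top (q := q) (p := r + 1) (by lia) (c₀ := (S / (r + 1)) ^ 2)
      (sq_nonneg _) (fun j hj => ?_) (fun j hj => ?_) (fun j => ?_) ?_).trans (le_of_eq ?_)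
    · rw [if_pos hj]
      exact pow_le_pow_left₀ (by positivity) (hlow j hj) 2
    · rw [if_neg (not_lt.2 hj)]
    · split_ifs <;> norm_num
    · simp [hh, add_assoc]
    · rw [← sum_filter_lt_eq_Icc (d := d) (by lia) fun i => singVal X i ^ 2]
      congr 1
      · refine Finset.sum_congr rfl fun j hj => ?_
        rw [if_pos (Finset.mem_filter.1 hj).2]
      · push_cast
        field_simp

/-- The diagonal of a multiple of a subgradient of the spectral `k`-support norm, on the first
singular directions. -/
noncomputable def subgradientDiag (q r : ℕ) (X : Matrix (Fin d) (Fin d) ℝ) (j : Fin d) : ℝ :=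
  if (j : ℕ) < q then
    (r + 1) * singVal X (j + 1) / ∑ i ∈ Finset.Icc (q + 1) X.rank, singVal X i
  else 1

theorem matInner_ofCoeff_dualArray {a b : OrthonormalBasis (Fin d) ℝ (EuclideanSpace ℝ (Fin d))}
    {X : Matrix (Fin d) (Fin d) ℝ}
    (hab : ∀ j, Matrix.toEuclideanLin X (b j) = singVal X (j + 1) • a j) (D : Fin d → ℝ)
    (z : EuclideanSpace ℝ (Fin d × Fin d)) :
    matInner X (ofCoeff a b (dualArray X.rank D z)) =
      ‖arrayOp (trailingBlock X.rank z)‖ *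
        ∑ j ∈ Finset.univ.filter (fun j : Fin d => (j : ℕ) < X.rank), D j * singVal X (j + 1) := by
  have hj : ∀ j, inner ℝ (a j) (Matrix.toEuclideanLin (ofCoeff a b (dualArray X.rank D z)) (b j)) =
      dualArray X.rank D z j j := fun j => coeffArray_ofCoeff a b _ (j, j)
  rw [matInner_eq_sum_inner b, Finset.mul_sum, Finset.sum_filter]
  refine Finset.sum_congr rfl fun j _ => ?_
  rw [hab, real_inner_smul_left, hj]
  split_ifs with h
  · simp only [dualArray, not_le.2 h, false_and, if_false, if_true]
    ring
  · rw [singVal_eq_zero (by lia), zero_mul]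

theorem sum_subgradientDiag_mul_singVal {q r : ℕ} {X : Matrix (Fin d) (Fin d) ℝ}
    (hS : 0 < ∑ i ∈ Finset.Icc (q + 1) X.rank, singVal X i) (hq : q ≤ X.rank) :
    ∑ j ∈ Finset.univ.filter (fun j : Fin d => (j : ℕ) < X.rank),
        subgradientDiag q r X j * singVal X (j + 1) =
      (r + 1) / (∑ i ∈ Finset.Icc (q + 1) X.rank, singVal X i) *
        (∑ i ∈ Finset.Icc 1 q, singVal X i ^ 2 +
          (∑ i ∈ Finset.Icc (q + 1) X.rank, singVal X i) ^ 2 / (r + 1)) := by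
  have hrank : X.rank ≤ d := by simpa using X.rank_le_card_width
  have hr0 : (0 : ℝ) < r + 1 := by positivity
  set S := ∑ i ∈ Finset.Icc (q + 1) X.rank, singVal X i with hSdef
  rw [← Finset.sum_filter_add_sum_filter_not _ (fun j : Fin d => (j : ℕ) < q),
    Finset.filter_filter, Finset.filter_filter]
  have e1 : (Finset.univ.filter fun j : Fin d => (j : ℕ) < X.rank ∧ (j : ℕ) < q) =
      Finset.univ.filter fun j : Fin d => (j : ℕ) < q := by
    ext j
    simp only [Finset.mem_filter, Finset.mem_univ, true_and]
    lia
  have e2 : (Finset.univ.filter fun j : Fin d => (j : ℕ) < X.rank ∧ ¬ (j : ℕ) < q) =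
      Finset.univ.filter fun j : Fin d => q ≤ (j : ℕ) ∧ (j : ℕ) < X.rank := by
    ext j
    simp only [Finset.mem_filter, Finset.mem_univ, true_and]
    lia
  have s1 : ∑ j ∈ Finset.univ.filter (fun j : Fin d => (j : ℕ) < q),
      subgradientDiag q r X j * singVal X (j + 1) =
      (r + 1) / S * ∑ i ∈ Finset.Icc 1 q, singVal X i ^ 2 := by
    rw [← sum_filter_lt_eq_Icc (d := d) (by lia) fun i => singVal X i ^ 2, Finset.mul_sum]
    refine Finset.sum_congr rfl fun j hj => ?_
    rw [subgradientDiag, if_pos (Finset.mem_filter.1 hj).2]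
    ring
  have s2 : ∑ j ∈ Finset.univ.filter (fun j : Fin d => q ≤ (j : ℕ) ∧ (j : ℕ) < X.rank),
      subgradientDiag q r X j * singVal X (j + 1) = S := by
    rw [hSdef, ← sum_filter_val_succ hrank]
    refine Finset.sum_congr rfl fun j hj => ?_
    rw [subgradientDiag, if_neg (not_lt.2 (Finset.mem_filter.1 hj).2.1), one_mul]
  rw [e1, e2, s1, s2]
  field_simp

/-- The sum of the squares of the entries of `subgradientDiag`. -/
theorem sum_subgradientDiag_sq {q r : ℕ} {X : Matrix (Fin d) (Fin d) ℝ} (hq : q ≤ X.rank) :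
    ∑ j : Fin d, (if X.rank ≤ (j : ℕ) then (0 : ℝ) else subgradientDiag q r X j ^ 2) =
      (r + 1) ^ 2 * (∑ i ∈ Finset.Icc 1 q, singVal X i ^ 2) /
        (∑ i ∈ Finset.Icc (q + 1) X.rank, singVal X i) ^ 2 +
      ((Finset.Icc (q + 1) X.rank).card : ℝ) := by
  have hrank : X.rank ≤ d := by simpa using X.rank_le_card_width
  set S := ∑ i ∈ Finset.Icc (q + 1) X.rank, singVal X i with hSdef
  have hsplit : ∀ j : Fin d,
      (if X.rank ≤ (j : ℕ) then (0 : ℝ) else subgradientDiag q r X j ^ 2) =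
      (if (j : ℕ) < q then (r + 1) ^ 2 / S ^ 2 * singVal X (j + 1) ^ 2 else 0) +
        (if q ≤ (j : ℕ) ∧ (j : ℕ) < X.rank then 1 else 0) := by
    intro j
    rw [subgradientDiag, ← hSdef]
    by_cases h1 : (j : ℕ) < q
    · rw [if_neg (by lia), if_pos h1, if_pos h1, if_neg (by lia)]
      ring
    · by_cases h2 : X.rank ≤ (j : ℕ)
      · rw [if_pos h2, if_neg h1, if_neg (by lia), add_zero]
      · rw [if_neg h2, if_neg h1, if_neg h1, if_pos (by lia)]
        ring
  simp only [hsplit]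
  rw [Finset.sum_add_distrib, ← Finset.sum_filter, ← Finset.sum_filter, ← Finset.mul_sum,
    sum_filter_lt_eq_Icc (by lia) fun i => singVal X i ^ 2,
    sum_filter_val_succ hrank fun _ => (1 : ℝ)]
  simp
  ring

/-- The scaled subgradient built from a coefficient array has a non-positive inner product with
every direction of descent. -/
theorem matInner_dualArray_nonpos {q r : ℕ} {X Δ : Matrix (Fin d) (Fin d) ℝ}
    (hr : IsKSupportIndex (q + r + 1) X r) (hqd : q + r + 1 ≤ X.rank)
    {a b : OrthonormalBasis (Fin d) ℝ (EuclideanSpace ℝ (Fin d))}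
    (hab : ∀ j, Matrix.toEuclideanLin X (b j) = singVal X (j + 1) • a j)
    (z : EuclideanSpace ℝ (Fin d × Fin d))
    (hΔ : spectralKSupportNorm (q + r + 1) (X + Δ) ≤ spectralKSupportNorm (q + r + 1) X) :
    matInner Δ (ofCoeff a b (dualArray X.rank (subgradientDiag q r X) z)) ≤ 0 := by
  obtain ⟨hS, hlow, hhigh⟩ := isKSupportIndex_bounds hr hqd
  have hrank : X.rank ≤ d := by simpa using X.rank_le_card_width
  have hnorm := spectralKSupportNorm_le hr hqd
  have hX := matInner_ofCoeff_dualArray hab (subgradientDiag q r X) z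
  rw [sum_subgradientDiag_mul_singVal hS (by lia)] at hX
  have hDdef : ∀ j : Fin d, (j : ℕ) < q → subgradientDiag q r X j =
      (r + 1) * singVal X (j + 1) / ∑ i ∈ Finset.Icc (q + 1) X.rank, singVal X i :=
    fun j hj => if_pos hj
  have hDdef' : ∀ j : Fin d, q ≤ (j : ℕ) → subgradientDiag q r X j = 1 :=
    fun j hj => if_neg (not_lt.2 hj)
  have hr0 : (0 : ℝ) < r + 1 := by positivity
  set S := ∑ i ∈ Finset.Icc (q + 1) X.rank, singVal X i
  set M := √(∑ i ∈ Finset.Icc 1 q, singVal X i ^ 2 + S ^ 2 / (r + 1)) with hM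
  have hM2 : M ^ 2 = ∑ i ∈ Finset.Icc 1 q, singVal X i ^ 2 + S ^ 2 / (r + 1) :=
    Real.sq_sqrt (by positivity)
  have hM0 : 0 ≤ M := Real.sqrt_nonneg _
  set t := ‖arrayOp (trailingBlock X.rank z)‖ with ht
  have ht0 : 0 ≤ t := norm_nonneg _
  set W := ofCoeff a b (dualArray X.rank (subgradientDiag q r X) z) with hW
  -- The squared stretch factors of W are t²D_j² ≥ t² on the first q directions and t² afterwards.
  -- Any k = q + (r+1) orthonormal vectors thus capture at most (t(r+1)/S)²M².
  have hdual : ∀ Y, matInner Y W ≤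
      (t * ((r + 1) / S) * M) * spectralKSupportNorm (q + r + 1) Y := by
    intro Y
    refine matInner_le_mul_spectralKSupportNorm (by lia) (by positivity) fun b' g hg => ?_
    refine (sum_norm_sq_le_top (q := q) (p := r + 1) (by lia)
      (T := fun x => Matrix.toEuclideanLin W x) (norm_sq_toEuclideanLin_dualArray_le a b _ _ z)
      (c₀ := t ^ 2) (sq_nonneg _) (fun j hj => ?_) (fun j hj => ?_) b'
      (by lia)).trans (le_of_eq ?_)
    · rw [if_neg (by lia), hDdef j hj]
      refine pow_le_pow_left₀ ht0 (le_mul_of_one_le_right ht0 ?_) 2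
      rw [one_le_div hS, ← div_le_iff₀' hr0]
      exact hlow j hj
    · split_ifs
      · rfl
      · rw [hDdef' j hj, mul_one]
    · have h1 : ∑ j ∈ Finset.univ.filter (fun j : Fin d => (j : ℕ) < q),
          (if X.rank ≤ (j : ℕ) then t ^ 2 else (t * subgradientDiag q r X j) ^ 2) =
          (t * ((r + 1) / S)) ^ 2 * ∑ i ∈ Finset.Icc 1 q, singVal X i ^ 2 := by
        rw [← sum_filter_lt_eq_Icc (d := d) (by lia) fun i => singVal X i ^ 2, Finset.mul_sum]
        refine Finset.sum_congr rfl fun j hj => ?_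
        have hj' := (Finset.mem_filter.1 hj).2
        rw [if_neg (by lia), hDdef j hj']
        ring
      rw [h1, mul_pow _ M, hM2]
      push_cast
      field_simp
  have h1 := hdual (X + Δ)
  have hadd : matInner (X + Δ) W = matInner X W + matInner Δ W := by
    simp [matInner, add_mul, Finset.sum_add_distrib]
  rw [hadd, hX, ← hM2] at h1
  -- The upper bound for ⟨X + Δ, W⟩ is now exactly the value of ⟨X, W⟩, which leaves ⟨Δ, W⟩ ≤ 0.
  have h2 : (t * ((r + 1) / S) * M) * spectralKSupportNorm (q + r + 1) (X + Δ) ≤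
      (t * ((r + 1) / S) * M) * M :=
    mul_le_mul_of_nonneg_left (hΔ.trans hnorm) (by positivity)
  nlinarith

/-- The half-space of matrices with non-positive inner product with a given matrix. -/
def matInnerNonposCone (W : Matrix (Fin d) (Fin d) ℝ) :
    ConvexCone ℝ (Matrix (Fin d) (Fin d) ℝ) where
  carrier := {X | matInner X W ≤ 0}
  smul_mem' := by
    intro c hc X hX
    have : matInner (c • X) W = c * matInner X W := by
      simp [matInner, Finset.mul_sum, mul_assoc]
    change matInner _ W ≤ 0
    rw [this]
    exact mul_nonpos_of_nonneg_of_nonpos hc.le hX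
  add_mem' := by
    intro X hX Y hY
    have : matInner (X + Y) W = matInner X W + matInner Y W := by
      simp [matInner, add_mul, Finset.sum_add_distrib]
    change matInner _ W ≤ 0
    rw [this]
    exact add_nonpos hX hY

theorem matInner_le_sqrt_dualArray_deviation {q r : ℕ} {Θ : Matrix (Fin d) (Fin d) ℝ}
    (hr : IsKSupportIndex (q + r + 1) Θ r) (hqd : q + r + 1 ≤ Θ.rank)
    {a b : OrthonormalBasis (Fin d) ℝ (EuclideanSpace ℝ (Fin d))}
    (hab : ∀ j, Matrix.toEuclideanLin Θ (b j) = singVal Θ (j + 1) • a j)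
    (G : Matrix (Fin d) (Fin d) ℝ) {X : Matrix (Fin d) (Fin d) ℝ}
    (hX : X ∈ errorSet (spectralKSupportNorm (q + r + 1)) Θ) :
    matInner X G ≤ √(∑ p : Fin d × Fin d, (coeffArray a b G p -
      dualArray Θ.rank (subgradientDiag q r Θ) (coeffArray a b G) p.1 p.2) ^ 2) := by
  set z := coeffArray a b G
  set w := dualArray Θ.rank (subgradientDiag q r Θ) z
  -- A half-space is a convex cone, so checking the generating descent directions is enough.
  have hle : errorCone (spectralKSupportNorm (q + r + 1)) Θ ≤
      matInnerNonposCone (ofCoeff a b w) :=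
    ConvexCone.hull_min fun Δ hΔ => matInner_dualArray_nonpos hr hqd hab z hΔ
  have h1 : matInner X (ofCoeff a b w) ≤ 0 := hle hX.1
  have h2 : ‖coeffArray a b X‖ = 1 := by
    rw [← sq_eq_sq₀ (norm_nonneg _) zero_le_one, ← real_inner_self_eq_norm_sq, inner_coeffArray,
      one_pow]
    have h : √(matInner X X) = 1 := hX.2
    rwa [Real.sqrt_eq_one] at h
  have h3 := real_inner_le_norm (coeffArray a b X) (z - coeffArray a b (ofCoeff a b w))
  rw [inner_sub_right, inner_coeffArray, inner_coeffArray, h2, one_mul, EuclideanSpace.norm_eq] at h3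
  simp only [PiLp.sub_apply, coeffArray_ofCoeff, Real.norm_eq_abs, sq_abs] at h3
  linarith

end

/-! ### The width bound. -/

theorem lemma1 (d k s r : ℕ) (Θ : Matrix (Fin d) (Fin d) ℝ)
    (hs : Θ.rank = s) (hks : k ≤ s) (hr : IsKSupportIndex k Θ r) :
    gaussianWidth (errorSet (spectralKSupportNorm k) Θ) ^ 2 ≤
      (s : ℝ) * (2 * (d : ℝ) - s) +
        2 * (((r : ℝ) + 1) ^ 2 * (∑ i ∈ Finset.Icc 1 (k - r - 1), singVal Θ i ^ 2) /
              (∑ i ∈ Finset.Icc (k - r) s, singVal Θ i) ^ 2 +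
            ((Finset.Icc (k - r) s).card : ℝ)) * (2 * (d : ℝ) - s) := by
  subst hs
  obtain ⟨q, rfl⟩ : ∃ q, k = q + r + 1 := ⟨k - r - 1, by have := hr.1; lia⟩
  rw [show q + r + 1 - r - 1 = q by lia, show q + r + 1 - r = q + 1 by lia]
  have hrank : Θ.rank ≤ d := by simpa using Θ.rank_le_card_width
  obtain ⟨a, b, hab⟩ := exists_singular_bases Θ
  set D := subgradientDiag q r Θ
  obtain ⟨hi, hle⟩ := integral_dualArray_deviation_sq_le hrank D
  rw [sum_subgradientDiag_sq (by lia)] at hle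
  set A := ((r : ℝ) + 1) ^ 2 * (∑ i ∈ Finset.Icc 1 q, singVal Θ i ^ 2) /
    (∑ i ∈ Finset.Icc (q + 1) Θ.rank, singVal Θ i) ^ 2 +
    ((Finset.Icc (q + 1) Θ.rank).card : ℝ)
  have hA : 0 ≤ A := by positivity
  set H : EuclideanSpace ℝ (Fin d × Fin d) → ℝ := fun z =>
    ∑ p : Fin d × Fin d, (z p - dualArray Θ.rank D z p.1 p.2) ^ 2
  have hH0 : ∀ z, 0 ≤ H z := fun z => Finset.sum_nonneg fun p _ => sq_nonneg _
  have hHc : Continuous H := by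
    have := fun i j => continuous_dualArray Θ.rank D i j
    fun_prop
  have hmp := measurePreserving_coeffArray a b
  have hHi := hmp.integrable_comp_of_integrable hi
  have hHe : ∫ G, H (coeffArray a b (Matrix.of G)) ∂(stdGaussianArray d d) =
      ∫ z, H z ∂(stdGaussian (EuclideanSpace ℝ (Fin d × Fin d))) := by
    rw [← hmp.map_eq, integral_map hmp.measurable.aemeasurable hHc.aestronglyMeasurable]
  have hmem : MemLp (fun G => √(H (coeffArray a b (Matrix.of G)))) 2 (stdGaussianArray d d) := by
    have hm : AEStronglyMeasurable (fun G => √(H (coeffArray a b (Matrix.of G))))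
        (stdGaussianArray d d) :=
      ((Real.continuous_sqrt.comp hHc).measurable.comp hmp.measurable).aestronglyMeasurable
    rw [memLp_two_iff_integrable_sq hm]
    simp only [Real.sq_sqrt (hH0 _)]
    exact hHi
  have hw := gaussianWidth_sq_le (S := errorSet (spectralKSupportNorm (q + r + 1)) Θ)
    Set.inter_subset_right hmem (fun G => Real.sqrt_nonneg _)
    fun G X hX => matInner_le_sqrt_dualArray_deviation hr hks hab (Matrix.of G) hX
  simp only [Real.sq_sqrt (hH0 _)] at hw
  rw [hHe] at hw
  -- The estimate obtained has 4(d-s)A in place of 2(2d-s)A; the difference is 2sA ≥ 0.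
  have h4 : (0 : ℝ) ≤ Θ.rank * A := by positivity
  linarith [hw.trans hle]
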